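/- For $n\ge 0$ let \[B_n(z)=\sum_{k=0}^n\binom{n}{k}^2\binom{n+k}{k}^2z^k\] be the Apéry polynomials. Let $x>0$. Then there is exactly one $\theta\in(0,1)$ with \[x=\frac{\sin^4(\frac{\pi}{2}\theta)}{4\cos^2(\frac{\pi}{2}\theta)},\] and with this $\theta$ we have, as $n\to\infty$, \[B_n(-x)=\frac{1}{(2\pi n)^{3/2}}\,\frac{(1+\sin(\frac{\pi}{2}\theta))(1+\frac12\tan^2(\frac{\pi}{2}\theta))}{\left(\frac12\tan(\frac{\pi}{2}\theta)\sqrt{1+\cos^2(\frac{\pi}{2}\theta)}\right)^{3/2}}\left\{\frac{1+\sin(\frac{\pi}{2}\theta)}{\cos(\frac{\pi}{2}\theta)}\right\}^{2n}\bigl(\cos\{f(\theta)+n\pi\theta\}+o(1)\bigr),\] where the phase shift is \[f(\theta)=2\arctan\left(\frac{\tan(\frac{\pi}{2}\theta)\,(1+\sin(\frac{\pi}{2}\theta))}{2+\sin(\frac{\pi}{2}\theta)}\right)-\frac32\arctan\left(\frac{1}{\cos(\frac{\pi}{2}\theta)}\right).\] -/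

import Mathlib

open Filter Topology

noncomputable section

/-- The `n`-th Apéry polynomial `B_n(z) = ∑_{k=0}^n C(n,k)² C(n+k,k)² z^k`. -/
def aperyPolynomial (n : ℕ) : Polynomial ℝ :=
  ∑ k ∈ Finset.range (n + 1),
    Polynomial.C ((n.choose k : ℝ) ^ 2 * ((n + k).choose k : ℝ) ^ 2) * Polynomial.X ^ k

/-- The parameterization `θ ↦ sin⁴(πθ/2) / (4 cos²(πθ/2))`. -/
def aperyParam (θ : ℝ) : ℝ :=
  Real.sin (Real.pi / 2 * θ) ^ 4 / (4 * Real.cos (Real.pi / 2 * θ) ^ 2)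

/-- The phase shift `f(θ)`. -/
def aperyPhase (θ : ℝ) : ℝ :=
  2 * Real.arctan
      (Real.tan (Real.pi / 2 * θ) * (1 + Real.sin (Real.pi / 2 * θ)) /
        (2 + Real.sin (Real.pi / 2 * θ)))
    - 3 / 2 * Real.arctan (1 / Real.cos (Real.pi / 2 * θ))

/-- The factor of the amplitude that does not depend on `n`. -/
def aperyAmplitude (θ : ℝ) : ℝ :=
  (1 + Real.sin (Real.pi / 2 * θ)) * (1 + 1 / 2 * Real.tan (Real.pi / 2 * θ) ^ 2) /
    (1 / 2 * Real.tan (Real.pi / 2 * θ) *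
      Real.sqrt (1 + Real.cos (Real.pi / 2 * θ) ^ 2)) ^ (3 / 2 : ℝ)

end

/-! Put `x = r²` and `u(φ) = i r e^{iφ}`, so that `u(φ) u(-φ) = -r²`. Orthogonality of the
exponentials makes `B_n(-x)` the circle average of `P_n(1 + 2u(φ)) P_n(1 + 2u(-φ))`, with `P_n` the
Legendre polynomial (`integral_legendreProduct_circle`). The reflection `φ ↦ π - φ` conjugates the
integrand, so the average is `1/π` times the real part of the integral over `|φ| ≤ π/2`, where the
only relevant saddle is `φ = 0`. The conjugate saddle at `φ = π` is what produces a cosine.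

Laplace's expansion writes `P_n(1 + 2u)` as `w^n` times a convergent sum, where `w + w⁻¹ = 2(1 +
2u)` and `|w| ≥ 1` (`legendreShifted_eq_laplaceSum`, `tendsto_sqrt_mul_sum`). Hence the integrand
near `φ = 0` behaves like `w(0)^{2n} / (π n (1 - w(0)⁻²))` times `(w(φ) w(-φ) / w(0)²)^n`. With `φ =
t/√n` the last power tends to a Gaussian (`tendsto_outerRoot_mul_pow`). A Gaussian majorant on the
whole half circle (`exists_norm_outerRoot_mul_le`, `exists_norm_legendreProduct_le`) then allows
dominated convergence (`tendsto_integral_legendreProduct`).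

With `α = πθ/2` and `r = sin² α / (2 cos α)` the number `u(1 + u)` at `u = i r` is an explicit
square. This makes `w(0)` equal to `(1 + sin α)/cos α · e^{iα}` (`outerRoot_saddle`) and gives the
amplitude and the phase in closed form (`saddle_constant`). -/

open Finset.HasAntidiagonal (antidiagonal)

/-! ### Shifted Legendre polynomials and their three-term recurrence -/

/-- The coefficient `C(n,k) C(n+k,k)` of the shifted Legendre polynomial. -/
noncomputable def legendreCoeff (n k : ℕ) : ℂ := (n.choose k : ℂ) * ((n + k).choose k : ℂ)

/-- The shifted Legendre polynomial `P_n(1 + 2u)`. -/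
noncomputable def legendreShifted (n : ℕ) (u : ℂ) : ℂ :=
  ∑ k ∈ Finset.range (n + 1), legendreCoeff n k * u ^ k

/-- The Taylor coefficients of `(1 - z)^(-1/2)`. -/
noncomputable def invSqrtCoeff (n : ℕ) : ℝ := (n.centralBinom : ℝ) / 4 ^ n

theorem legendreCoeff_eq_zero {n k : ℕ} (h : n < k) : legendreCoeff n k = 0 := by
  simp [legendreCoeff, Nat.choose_eq_zero_of_lt h]

/-- Writing `n = k + m` avoids truncated subtraction, so that identities between coefficients reduce
to factorials and `field_simp`. -/
theorem legendreCoeff_add (m k : ℕ) :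
    legendreCoeff (k + m) k =
      ((2 * k + m).factorial : ℂ) / ((k.factorial : ℂ) ^ 2 * (m.factorial : ℂ)) := by
  have h1 := Nat.add_choose_mul_factorial_mul_factorial k m
  have h2 := Nat.add_choose_mul_factorial_mul_factorial k (k + m)
  have h1' : ((k + m).choose k : ℂ) * k.factorial * m.factorial = (k + m).factorial := by
    rw [← Nat.choose_symm_add] at h1
    exact_mod_cast h1
  have h2' : ((k + m + k).choose k : ℂ) * k.factorial * (k + m).factorial
      = (2 * k + m).factorial := by
    rw [← Nat.choose_symm_add, show k + (k + m) = 2 * k + m by ring] at h2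
    rw [show k + m + k = 2 * k + m by ring]
    exact_mod_cast h2
  have hk : (k.factorial : ℂ) ≠ 0 := by exact_mod_cast k.factorial_ne_zero
  have hm : (m.factorial : ℂ) ≠ 0 := by exact_mod_cast m.factorial_ne_zero
  rw [eq_div_iff (by positivity), legendreCoeff, ← h2', ← h1']
  ring

theorem legendreCoeff_zero_right (n : ℕ) : legendreCoeff n 0 = 1 := by simp [legendreCoeff]

/-- Bonnet's recurrence, coefficient by coefficient. The top degrees are treated apart because some
coefficients vanish there and the factorial formula does not apply to them. -/
theorem legendreCoeff_recurrence (n k : ℕ) :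
    ((n : ℂ) + 2) * legendreCoeff (n + 2) (k + 1) =
      (2 * n + 3) * (legendreCoeff (n + 1) (k + 1) + 2 * legendreCoeff (n + 1) k)
        - (n + 1) * legendreCoeff n (k + 1) := by
  have hk : (k.factorial : ℂ) ≠ 0 := by exact_mod_cast k.factorial_ne_zero
  have hk1 : (k : ℂ) + 1 ≠ 0 := by exact_mod_cast k.succ_ne_zero
  have e1 : ∀ m : ℕ, ((m + 1).factorial : ℂ) = (m + 1) * m.factorial := fun m => by
    rw [Nat.factorial_succ]; push_cast; ring
  rcases lt_or_ge (n + 2) (k + 1) with h | h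
  · rw [legendreCoeff_eq_zero h, legendreCoeff_eq_zero (by omega : n + 1 < k + 1),
      legendreCoeff_eq_zero (by omega : n + 1 < k), legendreCoeff_eq_zero (by omega : n < k + 1)]
    ring
  rcases eq_or_lt_of_le h with h | h
  · obtain rfl : k = n + 1 := by omega
    rw [legendreCoeff_eq_zero (by omega : n + 1 < n + 1 + 1),
      legendreCoeff_eq_zero (by omega : n < n + 1 + 1)]
    have a1 := legendreCoeff_add 0 (n + 1 + 1)
    have a2 := legendreCoeff_add 0 (n + 1)
    simp only [add_zero, show 2 * (n + 1 + 1) = 2 * n + 1 + 1 + 1 + 1 by ring,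
      show 2 * (n + 1) = 2 * n + 1 + 1 by ring] at a1 a2
    rw [show n + 2 = n + 1 + 1 by ring, a1, a2]
    have : (n.factorial : ℂ) ≠ 0 := by exact_mod_cast n.factorial_ne_zero
    have h1 : (n : ℂ) + 1 ≠ 0 := by exact_mod_cast n.succ_ne_zero
    have h2 : (n : ℂ) + 1 + 1 ≠ 0 := by exact_mod_cast (n + 1).succ_ne_zero
    simp only [e1, Nat.factorial_zero]
    push_cast
    field_simp
    ring
  rcases eq_or_lt_of_le (Nat.le_of_lt_succ h) with h | h
  · obtain rfl : k = n := by omega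
    rw [legendreCoeff_eq_zero (by omega : k < k + 1)]
    have a1 := legendreCoeff_add 1 (k + 1)
    have a2 := legendreCoeff_add 0 (k + 1)
    have a3 := legendreCoeff_add 1 k
    simp only [add_zero, show 2 * (k + 1) = 2 * k + 1 + 1 by ring] at a1 a2 a3
    rw [show k + 2 = k + 1 + 1 by ring, a1, a2, a3]
    simp only [e1, Nat.factorial_zero, Nat.factorial_one]
    push_cast
    field_simp
    ring
  obtain ⟨m, rfl⟩ : ∃ m, n = k + 1 + m := ⟨n - (k + 1), by omega⟩
  have a1 := legendreCoeff_add (m + 1 + 1) (k + 1)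
  have a2 := legendreCoeff_add (m + 1) (k + 1)
  have a3 := legendreCoeff_add (m + 1 + 1) k
  have a4 := legendreCoeff_add m (k + 1)
  simp only [show 2 * (k + 1) + (m + 1 + 1) = 2 * k + m + 1 + 1 + 1 + 1 by ring,
    show 2 * (k + 1) + (m + 1) = 2 * k + m + 1 + 1 + 1 by ring,
    show 2 * (k + 1) + m = 2 * k + m + 1 + 1 by ring,
    show 2 * k + (m + 1 + 1) = 2 * k + m + 1 + 1 by ring] at a1 a2 a3 a4
  rw [show k + 1 + m + 2 = k + 1 + (m + 1 + 1) by ring, a1,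
    show k + 1 + m + 1 = k + 1 + (m + 1) by ring, a2,
    show k + 1 + (m + 1) = k + (m + 1 + 1) by ring, a3, a4]
  have : (m.factorial : ℂ) ≠ 0 := by exact_mod_cast m.factorial_ne_zero
  have h1 : (m : ℂ) + 1 ≠ 0 := by exact_mod_cast m.succ_ne_zero
  have h2 : (m : ℂ) + 1 + 1 ≠ 0 := by exact_mod_cast (m + 1).succ_ne_zero
  simp only [e1]
  push_cast
  field_simp
  ring

theorem legendreShifted_eq_sum_range {n N : ℕ} (h : n < N) (u : ℂ) :
    legendreShifted n u = ∑ k ∈ Finset.range N, legendreCoeff n k * u ^ k := by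
  refine Finset.sum_subset (Finset.range_mono h) fun k _ hk => ?_
  rw [legendreCoeff_eq_zero (by simpa using hk), zero_mul]

theorem legendreShifted_recurrence (n : ℕ) (u : ℂ) :
    ((n : ℂ) + 2) * legendreShifted (n + 2) u =
      (2 * n + 3) * (1 + 2 * u) * legendreShifted (n + 1) u - (n + 1) * legendreShifted n u := by
  have h1 : legendreShifted (n + 1) u * (1 + 2 * u) = 1 + ∑ k ∈ Finset.range (n + 2),
      (legendreCoeff (n + 1) (k + 1) + 2 * legendreCoeff (n + 1) k) * u ^ (k + 1) := by
    rw [mul_add, mul_one]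
    nth_rewrite 1 [legendreShifted_eq_sum_range (by omega : n + 1 < n + 2 + 1)]
    rw [legendreShifted_eq_sum_range (by omega : n + 1 < n + 2), Finset.sum_range_succ',
      Finset.sum_mul, legendreCoeff_zero_right, pow_zero, mul_one, add_comm _ (1 : ℂ), add_assoc,
      ← Finset.sum_add_distrib]
    congr 1
    exact Finset.sum_congr rfl fun k _ => by ring
  rw [mul_assoc, mul_comm (1 + 2 * u), h1, legendreShifted_eq_sum_range (by omega : n + 2 < n + 2 + 1),
    legendreShifted_eq_sum_range (by omega : n < n + 2 + 1), Finset.sum_range_succ',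
    Finset.sum_range_succ' (fun k => legendreCoeff n k * u ^ k)]
  simp only [legendreCoeff_zero_right, pow_zero, mul_one, mul_add, Finset.mul_sum]
  rw [← sub_eq_zero]
  have : ∀ a b c d e : ℂ, a + d - (e + b - (c + (n + 1))) = (a - b + c) + (d - e + n + 1) := by
    intros; ring
  rw [this, ← Finset.sum_sub_distrib, ← Finset.sum_add_distrib, Finset.sum_eq_zero]
  · ring
  · intro k _
    linear_combination u ^ (k + 1) * legendreCoeff_recurrence n k

/-! ### Laplace's expansion -/

theorem invSqrtCoeff_zero : invSqrtCoeff 0 = 1 := by simp [invSqrtCoeff]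

theorem invSqrtCoeff_pos (n : ℕ) : 0 < invSqrtCoeff n := by
  have := n.centralBinom_pos
  unfold invSqrtCoeff; positivity

theorem invSqrtCoeff_succ (n : ℕ) :
    ((n : ℝ) + 1) * invSqrtCoeff (n + 1) = (n + 1 / 2) * invSqrtCoeff n := by
  have h : ((n : ℝ) + 1) * (n + 1).centralBinom = 2 * (2 * n + 1) * n.centralBinom := by
    exact_mod_cast n.succ_mul_centralBinom_succ
  unfold invSqrtCoeff
  rw [← mul_div_assoc, h, pow_succ]
  field_simp
  ring

/-- The coefficient of `t^n` in `((1 - w t)(1 - w' t))^(-1/2)`. -/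
noncomputable def laplaceSum (n : ℕ) (w w' : ℂ) : ℂ :=
  ∑ p ∈ antidiagonal n, (invSqrtCoeff p.1 * w ^ p.1) * (invSqrtCoeff p.2 * w' ^ p.2)

/-- Coefficient form of the differential equation `(1 - w t) f' = (w/2) f` for `f = (1 - w
t)^(-1/2)`. The weight `p.1` kills the term lost in the index shift. -/
theorem sum_antidiagonal_fst_mul (n : ℕ) (w w' : ℂ) :
    ∑ p ∈ antidiagonal (n + 1), (p.1 : ℂ) *
        ((invSqrtCoeff p.1 * w ^ p.1) * (invSqrtCoeff p.2 * w' ^ p.2)) =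
      w * (∑ p ∈ antidiagonal n, (p.1 : ℂ) *
        ((invSqrtCoeff p.1 * w ^ p.1) * (invSqrtCoeff p.2 * w' ^ p.2))
        + laplaceSum n w w' / 2) := by
  rw [Finset.Nat.sum_antidiagonal_succ, laplaceSum, Finset.sum_div, ← Finset.sum_add_distrib,
    Finset.mul_sum]
  simp only [Nat.cast_zero, zero_mul, zero_add]
  refine Finset.sum_congr rfl fun p _ => ?_
  have h : ((p.1 : ℂ) + 1) * invSqrtCoeff (p.1 + 1) = (p.1 + 1 / 2) * invSqrtCoeff p.1 := by
    have := congrArg (fun y : ℝ => (y : ℂ)) (invSqrtCoeff_succ p.1)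
    push_cast at this
    exact this
  push_cast
  linear_combination w ^ (p.1 + 1) * (invSqrtCoeff p.2 * w' ^ p.2) * h

theorem sum_antidiagonal_snd_mul (n : ℕ) (w w' : ℂ) :
    ∑ p ∈ antidiagonal (n + 1), (p.2 : ℂ) *
        ((invSqrtCoeff p.1 * w ^ p.1) * (invSqrtCoeff p.2 * w' ^ p.2)) =
      w' * (∑ p ∈ antidiagonal n, (p.2 : ℂ) *
        ((invSqrtCoeff p.1 * w ^ p.1) * (invSqrtCoeff p.2 * w' ^ p.2))
        + laplaceSum n w w' / 2) := by
  rw [Finset.Nat.sum_antidiagonal_succ', laplaceSum, Finset.sum_div, ← Finset.sum_add_distrib,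
    Finset.mul_sum]
  simp only [Nat.cast_zero, zero_mul, zero_add]
  refine Finset.sum_congr rfl fun p _ => ?_
  have h : ((p.2 : ℂ) + 1) * invSqrtCoeff (p.2 + 1) = (p.2 + 1 / 2) * invSqrtCoeff p.2 := by
    have := congrArg (fun y : ℝ => (y : ℂ)) (invSqrtCoeff_succ p.2)
    push_cast at this
    exact this
  push_cast
  linear_combination w' ^ (p.2 + 1) * (invSqrtCoeff p.1 * w ^ p.1) * h

theorem sum_antidiagonal_fst_add_snd (n : ℕ) (w w' : ℂ) :
    ∑ p ∈ antidiagonal n, (p.1 : ℂ) *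
        ((invSqrtCoeff p.1 * w ^ p.1) * (invSqrtCoeff p.2 * w' ^ p.2)) +
      ∑ p ∈ antidiagonal n, (p.2 : ℂ) *
        ((invSqrtCoeff p.1 * w ^ p.1) * (invSqrtCoeff p.2 * w' ^ p.2)) =
      n * laplaceSum n w w' := by
  rw [laplaceSum, ← Finset.sum_add_distrib, Finset.mul_sum]
  refine Finset.sum_congr rfl fun p hp => ?_
  have : (n : ℂ) = p.1 + p.2 := by exact_mod_cast (Finset.HasAntidiagonal.mem_antidiagonal.1 hp).symm
  rw [this]; ring

/-- The sums weighted by `p.1` and by `p.2` add up to `n * laplaceSum n w w'`, and each has a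
first-order recurrence. Eliminating them with `w w' = 1` leaves the recurrence of the Legendre
polynomials. -/
theorem laplaceSum_recurrence (n : ℕ) {w w' : ℂ} (h : w * w' = 1) :
    ((n : ℂ) + 2) * laplaceSum (n + 2) w w' =
      (2 * n + 3) * ((w + w') / 2) * laplaceSum (n + 1) w w' - (n + 1) * laplaceSum n w w' := by
  have a1 := sum_antidiagonal_fst_mul (n + 1) w w'
  have a2 := sum_antidiagonal_snd_mul (n + 1) w w'
  have b1 := sum_antidiagonal_fst_mul n w w'
  have b2 := sum_antidiagonal_snd_mul n w w'
  have c2 := sum_antidiagonal_fst_add_snd (n + 2) w w'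
  have c1 := sum_antidiagonal_fst_add_snd (n + 1) w w'
  have c0 := sum_antidiagonal_fst_add_snd n w w'
  set X2 := ∑ p ∈ antidiagonal (n + 2), (p.1 : ℂ) *
        ((invSqrtCoeff p.1 * w ^ p.1) * (invSqrtCoeff p.2 * w' ^ p.2))
  set Y2 := ∑ p ∈ antidiagonal (n + 2), (p.2 : ℂ) *
        ((invSqrtCoeff p.1 * w ^ p.1) * (invSqrtCoeff p.2 * w' ^ p.2))
  set X1 := ∑ p ∈ antidiagonal (n + 1), (p.1 : ℂ) *
        ((invSqrtCoeff p.1 * w ^ p.1) * (invSqrtCoeff p.2 * w' ^ p.2))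
  set Y1 := ∑ p ∈ antidiagonal (n + 1), (p.2 : ℂ) *
        ((invSqrtCoeff p.1 * w ^ p.1) * (invSqrtCoeff p.2 * w' ^ p.2))
  set X0 := ∑ p ∈ antidiagonal n, (p.1 : ℂ) *
        ((invSqrtCoeff p.1 * w ^ p.1) * (invSqrtCoeff p.2 * w' ^ p.2))
  set Y0 := ∑ p ∈ antidiagonal n, (p.2 : ℂ) *
        ((invSqrtCoeff p.1 * w ^ p.1) * (invSqrtCoeff p.2 * w' ^ p.2))
  push_cast at c2 c1
  linear_combination -c2 + a1 + a2 + (w + w') * c1 - w' * b1 - w * b2 - c0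
    - (X0 + Y0 + laplaceSum n w w') * h

/-- Laplace's expansion of the Legendre polynomials. -/
theorem legendreShifted_eq_laplaceSum (n : ℕ) {u w w' : ℂ} (h : w * w' = 1)
    (hu : w + w' = 2 * (1 + 2 * u)) : legendreShifted n u = laplaceSum n w w' := by
  induction n using Nat.twoStepInduction with
  | zero => simp [legendreShifted, laplaceSum, legendreCoeff, invSqrtCoeff]
  | one =>
    have : invSqrtCoeff 1 = 1 / 2 := by norm_num [invSqrtCoeff, Nat.centralBinom, Nat.choose]
    simp [legendreShifted, laplaceSum, legendreCoeff, invSqrtCoeff_zero, this,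
      Finset.sum_range_succ, Finset.Nat.antidiagonal_succ]
    linear_combination - hu / 2
  | more n h0 h1 =>
    have a := legendreShifted_recurrence n u
    have b := laplaceSum_recurrence n h
    have hn : (n : ℂ) + 2 ≠ 0 := by exact_mod_cast (n + 1).succ_ne_zero
    apply mul_left_cancel₀ hn
    rw [a, b, h0, h1, hu]
    ring

/-- This is Laplace's expansion at `u = 0`, where `w = w' = 1` and `P_n(1) = 1`. -/
theorem sum_antidiagonal_invSqrtCoeff (n : ℕ) :
    ∑ p ∈ antidiagonal n, invSqrtCoeff p.1 * invSqrtCoeff p.2 = 1 := by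
  have h := legendreShifted_eq_laplaceSum n (u := 0) (w := 1) (w' := 1) (by norm_num) (by norm_num)
  have h0 : legendreShifted n 0 = 1 := by
    rw [legendreShifted, Finset.sum_range_succ']
    simp [legendreCoeff]
  rw [h0, laplaceSum] at h
  simp only [one_pow, mul_one] at h
  exact_mod_cast h.symm

/-- The coefficients are positive with sum `1`, and each monomial has modulus at most `|w|^n`. The
bound needs no gap between `|w|` and `1`, so it survives where the two roots meet on the unit
circle. -/
theorem norm_laplaceSum_le (n : ℕ) {w w' : ℂ} (h : w * w' = 1) (hw : 1 ≤ ‖w‖) :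
    ‖laplaceSum n w w'‖ ≤ ‖w‖ ^ n := by
  have hw' : ‖w'‖ ≤ 1 := by
    have : ‖w‖ * ‖w'‖ = 1 := by rw [← norm_mul, h, norm_one]
    nlinarith [norm_nonneg w']
  calc ‖laplaceSum n w w'‖ ≤ ∑ p ∈ antidiagonal n,
        invSqrtCoeff p.1 * invSqrtCoeff p.2 * ‖w‖ ^ n := by
        refine norm_sum_le_of_le _ fun p hp => ?_
        have h1 := (invSqrtCoeff_pos p.1).le
        have h2 := (invSqrtCoeff_pos p.2).le
        have h3 : ‖w‖ ^ p.1 ≤ ‖w‖ ^ n :=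
          pow_le_pow_right₀ hw (by
            have := Finset.HasAntidiagonal.mem_antidiagonal.1 hp; omega)
        have h4 : ‖w'‖ ^ p.2 ≤ 1 := pow_le_one₀ (norm_nonneg _) hw'
        rw [norm_mul, norm_mul, norm_mul, Complex.norm_of_nonneg h1, Complex.norm_of_nonneg h2,
          norm_pow, norm_pow, mul_mul_mul_comm]
        gcongr
        calc ‖w‖ ^ p.1 * ‖w'‖ ^ p.2 ≤ ‖w‖ ^ n * 1 := by gcongr
          _ = _ := mul_one _
    _ = ‖w‖ ^ n := by rw [← Finset.sum_mul, sum_antidiagonal_invSqrtCoeff, one_mul]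

/-! ### Asymptotics of the Laplace sum -/

theorem invSqrtCoeff_sq_mul_le (n : ℕ) : invSqrtCoeff n ^ 2 * (n + 1) ≤ 1 := by
  induction n with
  | zero => simp [invSqrtCoeff_zero]
  | succ n ih =>
    have h := invSqrtCoeff_succ n
    have hn : (0 : ℝ) ≤ n := n.cast_nonneg
    have h1 : invSqrtCoeff (n + 1) = (n + 1 / 2) * invSqrtCoeff n / (n + 1) := by
      rw [← h]; field_simp
    have h2 : invSqrtCoeff n ^ 2 ≤ 1 / (n + 1) := by
      rw [le_div_iff₀ (by positivity)]; exact ih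
    rw [h1, div_pow, mul_pow]
    push_cast
    rw [div_mul_eq_mul_div, div_le_one (by positivity)]
    calc ((n : ℝ) + 1 / 2) ^ 2 * invSqrtCoeff n ^ 2 * (n + 1 + 1)
        ≤ ((n : ℝ) + 1 / 2) ^ 2 * (1 / (n + 1)) * (n + 1 + 1) := by gcongr
      _ ≤ ((n : ℝ) + 1) ^ 2 := by
        rw [mul_one_div, div_mul_eq_mul_div, div_le_iff₀ (by positivity)]
        nlinarith [mul_nonneg hn hn]

theorem invSqrtCoeff_le_one (n : ℕ) : invSqrtCoeff n ≤ 1 := by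
  rw [invSqrtCoeff, div_le_one (by positivity)]
  exact_mod_cast n.centralBinom_le_four_pow

/-- A majorant uniform in `n`; its growth in `j` is harmless against a geometric factor `q ^ j`. -/
theorem sqrt_mul_invSqrtCoeff_sub_le {n j : ℕ} (h : j ≤ n) :
    √n * invSqrtCoeff (n - j) ≤ j + 1 := by
  have h1 := invSqrtCoeff_sq_mul_le (n - j)
  have h0 := (invSqrtCoeff_pos (n - j)).le
  obtain ⟨m, rfl⟩ := Nat.exists_eq_add_of_le h
  rw [Nat.add_sub_cancel_left] at *
  refine abs_le_of_sq_le_sq' ?_ (by positivity) |>.2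
  rw [mul_pow, Real.sq_sqrt (by positivity)]
  push_cast
  have hj : (0 : ℝ) ≤ j := j.cast_nonneg
  have hm : (0 : ℝ) ≤ m := m.cast_nonneg
  calc ((j : ℝ) + m) * invSqrtCoeff m ^ 2 ≤ ((j + 1) * (m + 1)) * invSqrtCoeff m ^ 2 := by
        gcongr; nlinarith
    _ = (j + 1) * (invSqrtCoeff m ^ 2 * (m + 1)) := by ring
    _ ≤ (j + 1) * 1 := by gcongr
    _ ≤ (j + 1) ^ 2 := by nlinarith

/-- By Stirling: the `n`-th term equals `stirlingSeq (2n) / (stirlingSeq n)²`. -/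
theorem tendsto_sqrt_mul_invSqrtCoeff :
    Tendsto (fun n : ℕ => √n * invSqrtCoeff n) atTop (𝓝 (1 / √Real.pi)) := by
  have h := Stirling.tendsto_stirlingSeq_sqrt_pi
  have hpi : √Real.pi ≠ 0 := by positivity
  have h2 : Tendsto (fun n : ℕ => Stirling.stirlingSeq (2 * n)) atTop (𝓝 (√Real.pi)) :=
    h.comp (tendsto_id.const_mul_atTop' two_pos)
  have h3 := h2.div (h.pow 2) (by positivity)
  have e : √Real.pi / √Real.pi ^ 2 = 1 / √Real.pi := by field_simp
  rw [e] at h3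
  refine h3.congr' ?_
  filter_upwards [eventually_ne_atTop 0] with n hn
  have hn' : (0 : ℝ) < n := by positivity
  have hs : √(n : ℝ) ^ 2 = n := Real.sq_sqrt hn'.le
  have hsq : √(2 * ((2 * n : ℕ) : ℝ)) = 2 * √(n : ℝ) := by
    push_cast
    rw [show (2 : ℝ) * (2 * n) = 2 ^ 2 * n by ring, Real.sqrt_mul (by positivity),
      Real.sqrt_sq (by norm_num)]
  have hc : (n.centralBinom : ℝ) = (2 * n).factorial / (n.factorial : ℝ) ^ 2 := by
    rw [Nat.centralBinom, Nat.cast_choose ℝ (by omega), show 2 * n - n = n by omega, sq]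
  have hf : (n.factorial : ℝ) ≠ 0 := by positivity
  have h2s : √(2 * (n : ℝ)) ^ 2 = 2 * n := Real.sq_sqrt (by positivity)
  simp only [Pi.div_apply, Stirling.stirlingSeq, invSqrtCoeff, hc, hsq, div_pow, mul_pow, h2s]
  push_cast
  rw [show (4 : ℝ) ^ n = 2 ^ (2 * n) by rw [pow_mul]; norm_num]
  field_simp
  rw [mul_pow, hs, ← pow_mul]
  ring_nf

theorem laplaceSum_eq (n : ℕ) {w w' : ℂ} (h : w * w' = 1) :
    laplaceSum n w w' = w ^ n * ∑ j ∈ Finset.range (n + 1),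
      (invSqrtCoeff (n - j) * invSqrtCoeff j : ℂ) * (w' ^ 2) ^ j := by
  rw [laplaceSum, Finset.Nat.sum_antidiagonal_eq_sum_range_succ_mk, ← Finset.sum_range_reflect,
    Finset.mul_sum]
  refine Finset.sum_congr rfl fun j hj => ?_
  have hj' : j ≤ n := by simpa [Nat.lt_succ_iff] using hj
  obtain ⟨m, rfl⟩ := Nat.exists_eq_add_of_le hj'
  simp only [show j + m + 1 - 1 - j = m by omega, show j + m - m = j by omega,
    show j + m - j = m by omega]
  have : w ^ j * w' ^ j = 1 := by rw [← mul_pow, h, one_pow]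
  rw [pow_add, ← pow_mul, mul_comm 2 j, pow_mul, sq]
  linear_combination (-(invSqrtCoeff m : ℂ) * invSqrtCoeff j * w ^ m * w' ^ j) * this

theorem summable_succ_mul_geometric {q : ℝ} (h0 : 0 ≤ q) (hq : q < 1) :
    Summable fun j : ℕ => ((j : ℝ) + 1) * q ^ j := by
  have h1 := summable_pow_mul_geometric_of_norm_lt_one 1 (r := q)
    (by rwa [Real.norm_of_nonneg h0])
  have h2 := summable_geometric_of_lt_one h0 hq
  refine (h1.add h2).congr fun j => ?_
  ring

theorem norm_sqrt_mul_term_le {n j : ℕ} (hj : j ≤ n) {q : ℝ} {z : ℂ} (hz : ‖z‖ ≤ q) :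
    ‖(√n : ℂ) * ((invSqrtCoeff (n - j) * invSqrtCoeff j : ℂ) * z ^ j)‖ ≤ (j + 1) * q ^ j := by
  have h1 := (invSqrtCoeff_pos (n - j)).le
  have h2 := (invSqrtCoeff_pos j).le
  rw [norm_mul, norm_mul, norm_mul, norm_pow, Complex.norm_of_nonneg h1, Complex.norm_of_nonneg h2,
    Complex.norm_of_nonneg (Real.sqrt_nonneg _)]
  calc √n * (invSqrtCoeff (n - j) * invSqrtCoeff j * ‖z‖ ^ j)
      = (√n * invSqrtCoeff (n - j)) * invSqrtCoeff j * ‖z‖ ^ j := by ring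
    _ ≤ (j + 1) * 1 * q ^ j := by
      gcongr
      · exact sqrt_mul_invSqrtCoeff_sub_le hj
      · exact invSqrtCoeff_le_one j
    _ = _ := by ring

theorem norm_sqrt_mul_sum_le (n : ℕ) {q : ℝ} (hq : q < 1) {z : ℂ} (hz : ‖z‖ ≤ q) :
    ‖(√n : ℂ) * ∑ j ∈ Finset.range (n + 1), (invSqrtCoeff (n - j) * invSqrtCoeff j : ℂ) * z ^ j‖
      ≤ ∑' j : ℕ, ((j : ℝ) + 1) * q ^ j := by
  have h0 : 0 ≤ q := (norm_nonneg z).trans hz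
  rw [Finset.mul_sum]
  refine (norm_sum_le_of_le _ fun j hj => norm_sqrt_mul_term_le
    (by simpa [Nat.lt_succ_iff] using hj) hz).trans ?_
  exact (summable_succ_mul_geometric h0 hq).sum_le_tsum _ fun j _ => by positivity

/-- Dominated convergence for series, the cutoff `j ≤ n` being part of the summand. The argument `z
n` varies because the sum is later evaluated at the angle `t/√n`. -/
theorem tendsto_sqrt_mul_sum {z : ℕ → ℂ} {z₀ : ℂ} (hz : Tendsto z atTop (𝓝 z₀)) (h : ‖z₀‖ < 1) :
    Tendsto (fun n : ℕ => (√n : ℂ) * ∑ j ∈ Finset.range (n + 1),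
      (invSqrtCoeff (n - j) * invSqrtCoeff j : ℂ) * z n ^ j) atTop
      (𝓝 ((1 / √Real.pi : ℝ) * ∑' j, (invSqrtCoeff j : ℂ) * z₀ ^ j)) := by
  obtain ⟨q, hq0, hq1⟩ := exists_between h
  have hq : 0 ≤ q := (norm_nonneg _).trans hq0.le
  have hb := hz.norm.eventually (eventually_le_nhds hq0)
  have key := tendsto_tsum_of_dominated_convergence (𝓕 := atTop)
    (f := fun (n j : ℕ) => if j ≤ n then
      (√n : ℂ) * ((invSqrtCoeff (n - j) * invSqrtCoeff j : ℂ) * z n ^ j) else 0)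
    (g := fun j => ((1 / √Real.pi : ℝ) : ℂ) * ((invSqrtCoeff j : ℂ) * z₀ ^ j))
    (summable_succ_mul_geometric hq hq1) ?_ ?_
  · rw [tsum_mul_left] at key
    refine key.congr fun n => ?_
    rw [tsum_eq_sum (s := Finset.range (n + 1)) (by
      intro j hj
      rw [if_neg]
      simpa [Nat.lt_succ_iff] using hj), Finset.mul_sum]
    refine Finset.sum_congr rfl fun j hj => ?_
    rw [if_pos (by simpa [Nat.lt_succ_iff] using hj)]
  · intro j
    have h1 : Tendsto (fun n : ℕ => √((n + j : ℕ) : ℝ) * invSqrtCoeff n) atTop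
        (𝓝 (1 / √Real.pi)) := by
      have a : Tendsto (fun n : ℕ => √(1 + (j : ℝ) / n)) atTop (𝓝 1) := by
        have := (tendsto_const_div_atTop_nhds_zero_nat (j : ℝ)).const_add 1
        simpa using this.sqrt
      have b := a.mul tendsto_sqrt_mul_invSqrtCoeff
      rw [one_mul] at b
      refine b.congr' ?_
      filter_upwards [eventually_ne_atTop 0] with n hn
      have hn' : (0 : ℝ) < n := by positivity
      rw [← mul_assoc, ← Real.sqrt_mul (by positivity)]
      congr 2
      push_cast
      field_simp
    have h2 : Tendsto (fun n : ℕ => √(n : ℝ) * invSqrtCoeff (n - j)) atTop (𝓝 (1 / √Real.pi)) := by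
      rw [← tendsto_add_atTop_iff_nat j]
      simpa using h1
    have h3 := ((Complex.continuous_ofReal.tendsto _).comp h2).mul
      ((hz.pow j).const_mul (invSqrtCoeff j : ℂ))
    refine h3.congr' ?_
    filter_upwards [eventually_ge_atTop j] with n hn
    rw [if_pos hn]
    simp only [Function.comp]
    push_cast
    ring
  · filter_upwards [hb] with n hn j
    split_ifs with hj
    · exact norm_sqrt_mul_term_le hj hn
    · simp; positivity

/-- Only the square of `(1 - z)^(-1/2)` occurs, since two Legendre factors meet at the saddle; no
branch has to be chosen. -/
theorem tsum_invSqrtCoeff_sq {z : ℂ} (h : ‖z‖ < 1) :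
    (∑' j, (invSqrtCoeff j : ℂ) * z ^ j) * (∑' j, (invSqrtCoeff j : ℂ) * z ^ j) = (1 - z)⁻¹ := by
  have hs : Summable fun j : ℕ => ‖(invSqrtCoeff j : ℂ) * z ^ j‖ := by
    refine Summable.of_nonneg_of_le (fun _ => norm_nonneg _) (fun j => ?_)
      (summable_geometric_of_lt_one (norm_nonneg z) h)
    rw [norm_mul, norm_pow, Complex.norm_of_nonneg (invSqrtCoeff_pos j).le]
    exact mul_le_of_le_one_left (by positivity) (invSqrtCoeff_le_one j)
  rw [tsum_mul_tsum_eq_tsum_sum_antidiagonal_of_summable_norm hs hs, ← tsum_geometric_of_norm_lt_one h]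
  congr 1
  ext n
  have e := congrArg (fun y : ℝ => (y : ℂ)) (sum_antidiagonal_invSqrtCoeff n)
  push_cast at e
  rw [← one_mul (z ^ n), ← e, Finset.sum_mul]
  refine Finset.sum_congr rfl fun p hp => ?_
  rw [← Finset.HasAntidiagonal.mem_antidiagonal.1 hp, pow_add]
  ring

/-! ### Square roots in the upper half plane and the two roots `w`, `w⁻¹` -/

/-- The principal square root. -/
noncomputable def csqrt (z : ℂ) : ℂ := z ^ ((2 : ℂ)⁻¹)

theorem csqrt_sq (z : ℂ) : csqrt z ^ 2 = z := Complex.cpow_ofNat_inv_pow z 2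

theorem csqrt_ne_zero {z : ℂ} (hz : z ≠ 0) : csqrt z ≠ 0 := by
  intro h
  apply hz
  rw [← csqrt_sq z, h]
  norm_num

theorem csqrt_eq_exp {z : ℂ} (hz : z ≠ 0) : csqrt z = Complex.exp (Complex.log z / 2) := by
  rw [csqrt, Complex.cpow_def_of_ne_zero hz, div_eq_mul_inv]

theorem re_csqrt_nonneg (z : ℂ) : 0 ≤ (csqrt z).re := by
  rcases eq_or_ne z 0 with rfl | hz
  · simp [csqrt]
  rw [csqrt_eq_exp hz, Complex.exp_re]
  have h1 := Complex.neg_pi_lt_arg z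
  have h2 := Complex.arg_le_pi z
  refine mul_nonneg (Real.exp_nonneg _) (Real.cos_nonneg_of_mem_Icc ?_)
  simp only [Complex.div_ofNat_im, Complex.log_im]
  constructor <;> linarith

theorem im_csqrt_nonneg {z : ℂ} (h : 0 ≤ z.im) : 0 ≤ (csqrt z).im := by
  rcases eq_or_ne z 0 with rfl | hz
  · simp [csqrt]
  rw [csqrt_eq_exp hz, Complex.exp_im]
  have h1 := Complex.arg_nonneg_iff.2 h
  have h2 := Complex.arg_le_pi z
  refine mul_nonneg (Real.exp_nonneg _) (Real.sin_nonneg_of_nonneg_of_le_pi ?_ ?_) <;>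
  simp only [Complex.div_ofNat_im, Complex.log_im] <;> linarith

theorem re_csqrt_mul_im_csqrt (z : ℂ) : 2 * ((csqrt z).re * (csqrt z).im) = z.im := by
  conv_rhs => rw [← csqrt_sq z]
  rw [sq, Complex.mul_im]
  ring

theorem re_csqrt_sq_sub_im_csqrt_sq (z : ℂ) : (csqrt z).re ^ 2 - (csqrt z).im ^ 2 = z.re := by
  conv_rhs => rw [← csqrt_sq z]
  rw [sq (csqrt z), Complex.mul_re]
  ring

theorem re_csqrt_pos {z : ℂ} (h : 0 < z.im) : 0 < (csqrt z).re := by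
  refine lt_of_le_of_ne (re_csqrt_nonneg z) fun h0 => ?_
  have := re_csqrt_mul_im_csqrt z
  rw [← h0] at this
  linarith

theorem im_csqrt_pos {z : ℂ} (h : 0 < z.im) : 0 < (csqrt z).im := by
  refine lt_of_le_of_ne (im_csqrt_nonneg h.le) fun h0 => ?_
  have := re_csqrt_mul_im_csqrt z
  rw [← h0] at this
  linarith

theorem hasDerivAt_csqrt {z : ℂ} (hz : z ∈ Complex.slitPlane) :
    HasDerivAt csqrt (1 / (2 * csqrt z)) z := by
  have h := (hasDerivAt_id z).cpow_const (c := (2 : ℂ)⁻¹) hz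
  refine h.congr_deriv ?_
  have hz0 : z ≠ 0 := Complex.slitPlane_ne_zero hz
  have : csqrt z ≠ 0 := csqrt_ne_zero hz0
  have e := csqrt_sq z
  simp only [id, mul_one]
  rw [Complex.cpow_sub _ _ hz0, Complex.cpow_one, ← csqrt]
  field_simp
  exact e

/-- The root `w` of `w + w⁻¹ = 2(1 + 2u)` outside the unit disc. -/
noncomputable def outerRoot (u : ℂ) : ℂ := (csqrt u + csqrt (1 + u)) ^ 2

/-- The root `w` of `w + w⁻¹ = 2(1 + 2u)` inside the unit disc. -/
noncomputable def innerRoot (u : ℂ) : ℂ := (csqrt (1 + u) - csqrt u) ^ 2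

theorem outerRoot_mul_innerRoot (u : ℂ) : outerRoot u * innerRoot u = 1 := by
  have h1 := csqrt_sq u
  have h2 := csqrt_sq (1 + u)
  have : csqrt (1 + u) ^ 2 - csqrt u ^ 2 = 1 := by rw [h1, h2]; ring
  rw [outerRoot, innerRoot]
  linear_combination (csqrt (1 + u) ^ 2 - csqrt u ^ 2 + 1) * this

theorem outerRoot_add_innerRoot (u : ℂ) : outerRoot u + innerRoot u = 2 * (1 + 2 * u) := by
  rw [outerRoot, innerRoot]
  linear_combination 2 * csqrt_sq u + 2 * csqrt_sq (1 + u)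

theorem outerRoot_ne_zero (u : ℂ) : outerRoot u ≠ 0 := fun h => by
  have := outerRoot_mul_innerRoot u
  rw [h, zero_mul] at this
  exact zero_ne_one this

theorem innerRoot_eq_inv (u : ℂ) : innerRoot u = (outerRoot u)⁻¹ :=
  eq_inv_of_mul_eq_one_right (outerRoot_mul_innerRoot u)

/-- The parallelogram law for `√u` and `√(1 + u)`. On a circle `|u| = r` the modulus of `w` is thus
governed by the distance from `u` to `-1` alone. -/
theorem norm_outerRoot_add_inv (u : ℂ) :
    ‖outerRoot u‖ + ‖outerRoot u‖⁻¹ = 2 * (‖u‖ + ‖1 + u‖) := by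
  have hp := parallelogram_law_with_norm ℝ (csqrt (1 + u)) (csqrt u)
  have h1 : ‖csqrt u‖ * ‖csqrt u‖ = ‖u‖ := by rw [← norm_mul, ← sq, csqrt_sq]
  have h2 : ‖csqrt (1 + u)‖ * ‖csqrt (1 + u)‖ = ‖1 + u‖ := by rw [← norm_mul, ← sq, csqrt_sq]
  rw [← norm_inv, ← innerRoot_eq_inv, outerRoot, innerRoot, norm_pow, norm_pow,
    add_comm (csqrt u)]
  linear_combination hp + 2 * h1 + 2 * h2

/-- Both square roots lie in the closed first quadrant, so their sum is at least as long as their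
difference. -/
theorem one_le_norm_outerRoot {u : ℂ} (h : 0 ≤ u.im) : 1 ≤ ‖outerRoot u‖ := by
  have h1 : ‖outerRoot u‖ * ‖innerRoot u‖ = 1 := by
    rw [← norm_mul, outerRoot_mul_innerRoot, norm_one]
  have h2 : ‖innerRoot u‖ ≤ ‖outerRoot u‖ := by
    rw [outerRoot, innerRoot, norm_pow, norm_pow, Complex.sq_norm, Complex.sq_norm,
      Complex.normSq_apply, Complex.normSq_apply]
    have a1 := re_csqrt_nonneg u
    have a2 := im_csqrt_nonneg h
    have b1 := re_csqrt_nonneg (1 + u)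
    have b2 := im_csqrt_nonneg (z := 1 + u) (by simpa using h)
    simp only [Complex.add_re, Complex.add_im, Complex.sub_re, Complex.sub_im]
    nlinarith [mul_nonneg a1 b1, mul_nonneg a2 b2]
  nlinarith [norm_nonneg (outerRoot u), norm_nonneg (innerRoot u)]

theorem one_add_mem_slitPlane {u : ℂ} (h : 0 < u.im) : 1 + u ∈ Complex.slitPlane :=
  Or.inr (by simpa using h.ne')

theorem hasDerivAt_outerRoot {u : ℂ} (h : 0 < u.im) :
    HasDerivAt outerRoot (outerRoot u / (csqrt u * csqrt (1 + u))) u := by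
  have hu : u ∈ Complex.slitPlane := Or.inr h.ne'
  have hu1 := one_add_mem_slitPlane h
  have h1 := hasDerivAt_csqrt hu
  have h2 := (hasDerivAt_csqrt hu1).comp u ((hasDerivAt_id u).const_add 1)
  refine ((h1.add h2).pow 2).congr_deriv ?_
  have n1 : csqrt u ≠ 0 := csqrt_ne_zero (Complex.slitPlane_ne_zero hu)
  have n2 : csqrt (1 + u) ≠ 0 := csqrt_ne_zero (Complex.slitPlane_ne_zero hu1)
  simp only [outerRoot, Pi.add_apply, Function.comp]
  push_cast
  field_simp
  ring

theorem hasDerivAt_csqrt_div {u : ℂ} (h : 0 < u.im) :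
    HasDerivAt (fun u => csqrt u / csqrt (1 + u)) (1 / (2 * csqrt u * csqrt (1 + u) ^ 3)) u := by
  have hu : u ∈ Complex.slitPlane := Or.inr h.ne'
  have hu1 := one_add_mem_slitPlane h
  have h1 := hasDerivAt_csqrt hu
  have h2 := (hasDerivAt_csqrt hu1).comp u ((hasDerivAt_id u).const_add 1)
  have n1 : csqrt u ≠ 0 := csqrt_ne_zero (Complex.slitPlane_ne_zero hu)
  have n2 : csqrt (1 + u) ≠ 0 := csqrt_ne_zero (Complex.slitPlane_ne_zero hu1)
  refine (h1.div h2 n2).congr_deriv ?_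
  have e : csqrt (1 + u) ^ 2 - csqrt u ^ 2 = 1 := by rw [csqrt_sq, csqrt_sq]; ring
  simp only [Function.comp]
  field_simp
  linear_combination e

/-! ### Decay of `|w(φ) w(-φ)|` along the half circle -/

/-- The point of argument `φ + π/2` on the circle of radius `r`. -/
noncomputable def circlePoint (r φ : ℝ) : ℂ := r * Complex.I * Complex.exp (φ * Complex.I)

theorem circlePoint_re (r φ : ℝ) : (circlePoint r φ).re = -(r * Real.sin φ) := by
  simp [circlePoint, Complex.exp_re, Complex.exp_im]

theorem circlePoint_im (r φ : ℝ) : (circlePoint r φ).im = r * Real.cos φ := by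
  simp [circlePoint, Complex.exp_re, Complex.exp_im]

theorem circlePoint_zero (r : ℝ) : circlePoint r 0 = r * Complex.I := by simp [circlePoint]

theorem norm_circlePoint {r : ℝ} (hr : 0 ≤ r) (φ : ℝ) : ‖circlePoint r φ‖ = r := by
  rw [circlePoint, norm_mul, norm_mul, Complex.norm_exp_ofReal_mul_I, Complex.norm_of_nonneg hr]
  simp

theorem norm_one_add_circlePoint_sq (r φ : ℝ) :
    ‖1 + circlePoint r φ‖ ^ 2 = 1 + r ^ 2 - 2 * r * Real.sin φ := by
  rw [Complex.sq_norm, Complex.normSq_apply]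
  simp only [Complex.add_re, Complex.add_im, Complex.one_re, Complex.one_im, circlePoint_re,
    circlePoint_im]
  linear_combination r ^ 2 * Real.sin_sq_add_cos_sq φ

theorem hasDerivAt_circlePoint (r φ : ℝ) :
    HasDerivAt (circlePoint r) (Complex.I * circlePoint r φ) φ := by
  have h : HasDerivAt (fun z : ℂ => r * Complex.I * Complex.exp (z * Complex.I))
      (Complex.I * circlePoint r φ) (φ : ℂ) := by
    refine ((((hasDerivAt_id (φ : ℂ)).mul_const Complex.I).cexp).const_mul
      (r * Complex.I)).congr_deriv ?_
    simp only [circlePoint, id]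
    ring
  exact h.comp_ofReal

theorem continuous_circlePoint (r : ℝ) : Continuous (circlePoint r) := by
  unfold circlePoint
  fun_prop

/-- On `[1, ∞)` the function `S + S⁻¹` increases with slope at most `1`, so a drop of `δ` in its
value forces a drop of at least `δ` in `S`. -/
theorem le_sub_of_add_inv_le {S S₀ δ : ℝ} (hS : 1 ≤ S) (hS₀ : 1 ≤ S₀) (hδ : 0 ≤ δ)
    (h : S + S⁻¹ ≤ S₀ + S₀⁻¹ - δ) : S ≤ S₀ - δ := by
  have hP : 0 < S * S₀ := by positivity
  have key : δ * (S * S₀) ≤ (S₀ - S) * (S * S₀ - 1) := by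
    have e : (S₀ - S) * (S * S₀ - 1) = (S₀ + S₀⁻¹ - (S + S⁻¹)) * (S * S₀) := by
      field_simp
      ring
    rw [e]
    exact mul_le_mul_of_nonneg_right (by linarith) hP.le
  have h1 : 1 ≤ S * S₀ := one_le_mul_of_one_le_of_one_le hS hS₀
  have hle : S ≤ S₀ := by
    by_contra! hlt
    have h2 : 0 < S * S₀ - 1 := by nlinarith
    have h3 := mul_pos (sub_pos.2 hlt) h2
    have h4 : 0 ≤ δ * (S * S₀) := by positivity
    linarith
  have h5 : δ * (S * S₀) ≤ (S₀ - S) * (S * S₀) := by linarith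
  linarith [le_of_mul_le_mul_right h5 hP]

/-- If `m + m⁻¹` and `m' + m'⁻¹` are given by the distances of two opposite points of a circle to
`-1`, then `m m'` is largest when the distances agree. -/
theorem mul_le_sq_sub {r σ A B m m' m₀ : ℝ} (hr : 0 ≤ r) (hσ : σ ^ 2 ≤ 1)
    (hA2 : A ^ 2 = 1 + r ^ 2 - 2 * r * σ)
    (hB2 : B ^ 2 = 1 + r ^ 2 + 2 * r * σ) (hm : 1 ≤ m) (hm' : 1 ≤ m') (hm₀ : 1 ≤ m₀)
    (h : m + m⁻¹ = 2 * (r + A)) (h' : m' + m'⁻¹ = 2 * (r + B))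
    (h₀ : m₀ + m₀⁻¹ = 2 * (r + √(1 + r ^ 2))) :
    m * m' ≤ m₀ ^ 2 - 8 * r ^ 2 * σ ^ 2 / (1 + r ^ 2) := by
  set E := 1 + r ^ 2 with hE
  have hE0 : 1 ≤ E := by nlinarith
  set R := √E
  have hR0 : 0 ≤ R := Real.sqrt_nonneg _
  have hR : R ^ 2 = E := Real.sq_sqrt (by linarith)
  -- This `τ` makes `(AB)² = E² - 4τE ≤ (E - 2τ)²`; the loss `2τ` in `AB` becomes `8τ` in `4(r +
  -- A)(r + B)`.
  set τ := r ^ 2 * σ ^ 2 / E with hτ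
  have hτE : τ * E = r ^ 2 * σ ^ 2 := by rw [hτ]; field_simp
  have hτ0 : 0 ≤ τ := by positivity
  have hτ1 : 2 * τ ≤ E := by
    have : r ^ 2 * σ ^ 2 ≤ r ^ 2 := by nlinarith [sq_nonneg r]
    nlinarith [sq_nonneg (r ^ 2 - 1)]
  have hAB : A * B ≤ E - 2 * τ := by
    refine abs_le_of_sq_le_sq' ?_ (by linarith) |>.2
    have : (A * B) ^ 2 = E ^ 2 - 4 * (r ^ 2 * σ ^ 2) := by
      rw [mul_pow, hA2, hB2]; ring
    rw [this, ← hτE]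
    nlinarith [sq_nonneg τ]
  have hApB : A + B ≤ 2 * R := by
    refine abs_le_of_sq_le_sq' ?_ (by linarith) |>.2
    nlinarith
  have hm0 : (0 : ℝ) < m := by linarith
  have hm0' : (0 : ℝ) < m' := by linarith
  have hm00 : (0 : ℝ) < m₀ := by linarith
  have hS : m * m' + (m * m')⁻¹ ≤ m₀ ^ 2 + (m₀ ^ 2)⁻¹ - 8 * τ := by
    have e1 : (m + m⁻¹) * (m' + m'⁻¹) = m * m' + (m * m')⁻¹ + (m / m' + m' / m) := by
      field_simp
      ring
    have e2 : 2 ≤ m / m' + m' / m := by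
      rw [div_add_div _ _ hm0'.ne' hm0.ne', le_div_iff₀ (by positivity)]
      nlinarith [sq_nonneg (m - m')]
    have e3 : (m₀ + m₀⁻¹) ^ 2 = m₀ ^ 2 + (m₀ ^ 2)⁻¹ + 2 := by
      field_simp
      ring
    rw [h, h'] at e1
    rw [h₀] at e3
    nlinarith [mul_le_mul_of_nonneg_left hApB hr]
  have e8 : 8 * r ^ 2 * σ ^ 2 / E = 8 * τ := by rw [hτ]; ring
  rw [e8]
  exact le_sub_of_add_inv_le (one_le_mul_of_one_le_of_one_le hm hm') (one_le_pow₀ hm₀)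
    (by positivity) hS

theorem circlePoint_im_nonneg {r φ : ℝ} (hr : 0 ≤ r) (hφ : |φ| ≤ Real.pi / 2) :
    0 ≤ (circlePoint r φ).im := by
  rw [circlePoint_im]
  exact mul_nonneg hr (Real.cos_nonneg_of_mem_Icc (abs_le.1 hφ))

theorem circlePoint_im_pos {r φ : ℝ} (hr : 0 < r) (hφ : |φ| < Real.pi / 2) :
    0 < (circlePoint r φ).im := by
  rw [circlePoint_im]
  exact mul_pos hr (Real.cos_pos_of_mem_Ioo (abs_lt.1 hφ))

theorem norm_outerRoot_circlePoint_zero_add_inv {r : ℝ} (hr : 0 ≤ r) :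
    ‖outerRoot (circlePoint r 0)‖ + ‖outerRoot (circlePoint r 0)‖⁻¹ = 2 * (r + √(1 + r ^ 2)) := by
  rw [norm_outerRoot_add_inv, norm_circlePoint hr]
  have h := norm_one_add_circlePoint_sq r 0
  rw [Real.sin_zero, mul_zero, sub_zero] at h
  rw [← h, Real.sqrt_sq (norm_nonneg _)]

theorem one_lt_norm_outerRoot_circlePoint_zero {r : ℝ} (hr : 0 < r) :
    1 < ‖outerRoot (circlePoint r 0)‖ := by
  have h1 := one_le_norm_outerRoot (circlePoint_im_nonneg (φ := 0) hr.le (by simp; positivity))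
  refine lt_of_le_of_ne h1 fun h => ?_
  have h2 := norm_outerRoot_circlePoint_zero_add_inv hr.le
  rw [← h] at h2
  have : 1 ≤ √(1 + r ^ 2) := Real.one_le_sqrt.2 (by nlinarith)
  norm_num at h2
  linarith

/-- On the half circle, `|w(φ) w(-φ)|` decays like a Gaussian away from `φ = 0`. -/
theorem exists_norm_outerRoot_mul_le {r : ℝ} (hr : 0 < r) :
    ∃ c > 0, ∀ φ : ℝ, |φ| ≤ Real.pi / 2 →
      ‖outerRoot (circlePoint r φ)‖ * ‖outerRoot (circlePoint r (-φ))‖ ≤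
        ‖outerRoot (circlePoint r 0)‖ ^ 2 * Real.exp (-c * φ ^ 2) := by
  set m₀ := ‖outerRoot (circlePoint r 0)‖ with hm₀
  have h1 : 1 < m₀ := one_lt_norm_outerRoot_circlePoint_zero hr
  have hπ := Real.pi_pos
  -- The factor `(2/π)²` comes from Jordan's inequality `|sin φ| ≥ (2/π)|φ|`; dividing by `m₀²`
  -- prepares for `1 - d φ² ≤ exp(-d φ²)`.
  refine ⟨8 * r ^ 2 * (2 / Real.pi) ^ 2 / ((1 + r ^ 2) * m₀ ^ 2), by positivity, fun φ hφ => ?_⟩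
  have hφ' : |-φ| ≤ Real.pi / 2 := by rwa [abs_neg]
  have h := mul_le_sq_sub hr.le (Real.sin_sq_le_one φ)
    (norm_one_add_circlePoint_sq r φ)
    (by rw [norm_one_add_circlePoint_sq r (-φ), Real.sin_neg]; ring)
    (one_le_norm_outerRoot (circlePoint_im_nonneg hr.le hφ))
    (one_le_norm_outerRoot (circlePoint_im_nonneg hr.le hφ')) h1.le
    (by rw [norm_outerRoot_add_inv, norm_circlePoint hr.le])
    (by rw [norm_outerRoot_add_inv, norm_circlePoint hr.le])
    (norm_outerRoot_circlePoint_zero_add_inv hr.le)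
  refine h.trans ?_
  have hs : (2 / Real.pi) ^ 2 * φ ^ 2 ≤ Real.sin φ ^ 2 := by
    have := Real.mul_abs_le_abs_sin hφ
    have := pow_le_pow_left₀ (by positivity) this 2
    rwa [mul_pow, sq_abs, sq_abs] at this
  set d := 8 * r ^ 2 * (2 / Real.pi) ^ 2 / ((1 + r ^ 2) * m₀ ^ 2)
  have he := Real.add_one_le_exp (-d * φ ^ 2)
  calc m₀ ^ 2 - 8 * r ^ 2 * Real.sin φ ^ 2 / (1 + r ^ 2)
      ≤ m₀ ^ 2 - 8 * r ^ 2 * ((2 / Real.pi) ^ 2 * φ ^ 2) / (1 + r ^ 2) := by gcongr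
    _ = m₀ ^ 2 * (-d * φ ^ 2 + 1) := by
      simp only [d]
      field_simp
      ring
    _ ≤ _ := by gcongr

/-! ### Local expansion at the saddle and the Gaussian limit -/

/-- The Hessian of the phase at the saddle point. -/
noncomputable def saddleHessian (u : ℂ) : ℂ := csqrt u / csqrt (1 + u) ^ 3

theorem hasDerivAt_outerRoot_circlePoint {r φ : ℝ} (hr : 0 < r) (hφ : |φ| < Real.pi / 2) :
    HasDerivAt (fun φ : ℝ => outerRoot (circlePoint r φ))
      (Complex.I * (csqrt (circlePoint r φ) / csqrt (1 + circlePoint r φ)) *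
        outerRoot (circlePoint r φ)) φ := by
  have him := circlePoint_im_pos hr hφ
  refine ((hasDerivAt_outerRoot him).comp φ (hasDerivAt_circlePoint r φ)).congr_deriv ?_
  have n1 : csqrt (circlePoint r φ) ≠ 0 :=
    csqrt_ne_zero (Complex.slitPlane_ne_zero (Or.inr him.ne'))
  have n2 : csqrt (1 + circlePoint r φ) ≠ 0 :=
    csqrt_ne_zero (Complex.slitPlane_ne_zero (one_add_mem_slitPlane him))
  have e := csqrt_sq (circlePoint r φ)
  field_simp
  linear_combination -outerRoot (circlePoint r φ) * e

theorem hasDerivAt_csqrt_div_circlePoint {r φ : ℝ} (hr : 0 < r) (hφ : |φ| < Real.pi / 2) :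
    HasDerivAt (fun φ : ℝ => csqrt (circlePoint r φ) / csqrt (1 + circlePoint r φ))
      (Complex.I / 2 * saddleHessian (circlePoint r φ)) φ := by
  have him := circlePoint_im_pos hr hφ
  refine ((hasDerivAt_csqrt_div him).comp φ (hasDerivAt_circlePoint r φ)).congr_deriv ?_
  have n1 : csqrt (circlePoint r φ) ≠ 0 :=
    csqrt_ne_zero (Complex.slitPlane_ne_zero (Or.inr him.ne'))
  have n2 : csqrt (1 + circlePoint r φ) ≠ 0 :=
    csqrt_ne_zero (Complex.slitPlane_ne_zero (one_add_mem_slitPlane him))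
  have e := csqrt_sq (circlePoint r φ)
  rw [saddleHessian]
  field_simp
  linear_combination -e

theorem HasDerivAt.comp_neg_real {f : ℝ → ℂ} {f' : ℂ} {x : ℝ} (h : HasDerivAt f f' (-x)) :
    HasDerivAt (fun y => f (-y)) (-f') x := by
  exact (h.scomp x (hasDerivAt_neg x)).congr_deriv (by simp)

/-- Second order expansion of `w(φ) w(-φ) / w(0)²` at `φ = 0`. -/
theorem outerRoot_mul_isLittleO {r : ℝ} (hr : 0 < r) :
    (fun φ : ℝ => outerRoot (circlePoint r φ) * outerRoot (circlePoint r (-φ)) /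
        outerRoot (circlePoint r 0) ^ 2 - 1 + saddleHessian (circlePoint r 0) / 2 * (φ : ℂ) ^ 2)
      =o[𝓝 0] fun φ : ℝ => φ ^ 2 := by
  set W : ℝ → ℂ := fun φ => outerRoot (circlePoint r φ) with hW
  set ρ : ℝ → ℂ := fun φ => csqrt (circlePoint r φ) / csqrt (1 + circlePoint r φ) with hρ
  set K := saddleHessian (circlePoint r 0) with hK
  have hW0 : W 0 ≠ 0 := outerRoot_ne_zero _
  have hπ : 0 < Real.pi / 2 := by positivity
  have hG : ∀ φ : ℝ, |φ| < Real.pi / 2 → HasDerivAt (fun φ => W φ * W (-φ) / W 0 ^ 2)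
      (Complex.I * (ρ φ - ρ (-φ)) * (W φ * W (-φ) / W 0 ^ 2)) φ := by
    intro φ hφ
    have h1 := hasDerivAt_outerRoot_circlePoint hr hφ
    have h2 := (hasDerivAt_outerRoot_circlePoint hr (by rwa [abs_neg] : |-φ| < _)).comp_neg_real
    refine ((h1.mul h2).div_const (W 0 ^ 2)).congr_deriv ?_
    simp only [hW, hρ]
    ring
  have hsq : ∀ φ : ℝ, HasDerivAt (fun φ : ℝ => K / 2 * (φ : ℂ) ^ 2) (K * φ) φ := by
    intro φ
    have h := ((hasDerivAt_id (φ : ℂ)).pow 2).const_mul (K / 2)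
    refine h.comp_ofReal.congr_deriv ?_
    simp
    ring
  -- It suffices that this derivative is `o(φ)`, since integrating then gives `o(φ²)`. It vanishes
  -- at `0`, and so does its own derivative, which is `i (iK/2 + iK/2) + K`.
  set f' : ℝ → ℂ := fun φ =>
    Complex.I * (ρ φ - ρ (-φ)) * (W φ * W (-φ) / W 0 ^ 2) + K * φ with hf'
  have hs : Set.Ioo (-(Real.pi / 2)) (Real.pi / 2) ∈ 𝓝 (0 : ℝ) :=
    Ioo_mem_nhds (by linarith) hπ
  have key := (convex_Ioo (-(Real.pi / 2)) (Real.pi / 2)).isLittleO_pow_succ_real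
    (f := fun φ => W φ * W (-φ) / W 0 ^ 2 + K / 2 * (φ : ℂ) ^ 2) (f' := f') (x₀ := 0) (n := 1)
    (mem_of_mem_nhds hs)
    (fun φ hφ => ((hG φ (abs_lt.2 hφ)).add (hsq φ)).hasDerivWithinAt) ?_
  · rw [nhdsWithin_eq_nhds.2 hs] at key
    refine key.congr (fun φ => ?_) (fun φ => by simp)
    have : W 0 * W (-0) / W 0 ^ 2 = 1 := by rw [neg_zero]; field_simp
    rw [this]
    simp only [hW, Complex.ofReal_zero]
    ring
  · rw [nhdsWithin_eq_nhds.2 hs]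
    have h0 : |(0 : ℝ)| < Real.pi / 2 := by simpa using hπ
    have hr1 := hasDerivAt_csqrt_div_circlePoint hr h0
    have hr2 := (hasDerivAt_csqrt_div_circlePoint hr (by rwa [neg_zero] : |-(0 : ℝ)| < _)).comp_neg_real
    have hd : HasDerivAt f' 0 0 := by
      have hid : HasDerivAt (fun φ : ℝ => K * (φ : ℂ)) K 0 := by
        simpa using ((hasDerivAt_id ((0 : ℝ) : ℂ)).const_mul K).comp_ofReal
      refine ((((hr1.sub hr2).const_mul Complex.I).mul (hG 0 h0)).add hid).congr_deriv ?_
      simp only [neg_zero, sub_self, Pi.sub_apply, mul_zero, zero_mul, add_zero]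
      have : W 0 * W 0 / W 0 ^ 2 = 1 := by field_simp
      rw [this, ← hK]
      linear_combination K * Complex.I_mul_I
    have := hasDerivAt_iff_isLittleO.1 hd
    refine this.congr (fun φ => ?_) (fun φ => by simp)
    simp [hf']

theorem tendsto_div_sqrt_natCast (t : ℝ) : Tendsto (fun n : ℕ => t / √(n : ℝ)) atTop (𝓝 0) :=
  (Real.tendsto_sqrt_atTop.comp tendsto_natCast_atTop_atTop).const_div_atTop t

/-- The limit `(1 + x_n/n)^n → e^x`, with `x_n → -K t²/2` read off from the second-order expansion.
-/
theorem tendsto_outerRoot_mul_pow {r : ℝ} (hr : 0 < r) (t : ℝ) :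
    Tendsto (fun n : ℕ => (outerRoot (circlePoint r (t / √n)) * outerRoot (circlePoint r (-(t / √n))) /
        outerRoot (circlePoint r 0) ^ 2) ^ n) atTop
      (𝓝 (Complex.exp (-(saddleHessian (circlePoint r 0) / 2) * (t : ℂ) ^ 2))) := by
  have h := (outerRoot_mul_isLittleO hr).comp_tendsto (tendsto_div_sqrt_natCast t)
  set G : ℝ → ℂ := fun φ => outerRoot (circlePoint r φ) * outerRoot (circlePoint r (-φ)) /
        outerRoot (circlePoint r 0) ^ 2 with hG
  set K := saddleHessian (circlePoint r 0)
  have hn : Tendsto (fun n : ℕ => (n : ℂ) * (G (t / √n) - 1 + K / 2 * ((t / √n : ℝ) : ℂ) ^ 2))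
      atTop (𝓝 0) := by
    have h1 : (fun n : ℕ => (n : ℂ) * (G (t / √n) - 1 + K / 2 * ((t / √n : ℝ) : ℂ) ^ 2))
        =o[atTop] fun n : ℕ => (n : ℝ) * (t / √n) ^ 2 := by
      refine Asymptotics.IsBigO.mul_isLittleO ?_ h
      exact Asymptotics.IsBigO.of_bound 1 (by simp)
    have h2 : (fun n : ℕ => (n : ℝ) * (t / √n) ^ 2) =O[atTop] fun _ => (1 : ℝ) := by
      refine Asymptotics.IsBigO.of_bound (t ^ 2) ?_
      filter_upwards [eventually_ne_atTop 0] with n hn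
      rw [div_pow, Real.sq_sqrt n.cast_nonneg, mul_div_cancel₀ _ (by exact_mod_cast hn)]
      simp
    exact (Asymptotics.isLittleO_one_iff ℝ).1 (h1.trans_isBigO h2)
  have hm : Tendsto (fun n : ℕ => (n : ℂ) * (G (t / √n) - 1)) atTop
      (𝓝 (-(K / 2) * (t : ℂ) ^ 2)) := by
    have := hn.add_const (-(K / 2) * (t : ℂ) ^ 2)
    rw [zero_add] at this
    refine this.congr' ?_
    filter_upwards [eventually_ne_atTop 0] with n hn
    have hn' : (n : ℂ) ≠ 0 := by exact_mod_cast hn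
    have : (n : ℂ) * ((t / √n : ℝ) : ℂ) ^ 2 = (t : ℂ) ^ 2 := by
      rw [← Complex.ofReal_pow, div_pow, Real.sq_sqrt n.cast_nonneg]
      push_cast
      field_simp
    linear_combination K / 2 * this
  refine (Complex.tendsto_one_add_pow_exp_of_tendsto hm).congr fun n => ?_
  simp [hG]

/-! ### Laplace's method on the half circle -/

/-- The normalized Laplace sum `P_n(1 + 2u) / w^n`. -/
noncomputable def laplaceTail (n : ℕ) (z : ℂ) : ℂ :=
  ∑ j ∈ Finset.range (n + 1), (invSqrtCoeff (n - j) * invSqrtCoeff j : ℂ) * z ^ j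

theorem legendreShifted_eq_outerRoot_pow_mul (n : ℕ) (u : ℂ) :
    legendreShifted n u = outerRoot u ^ n * laplaceTail n (innerRoot u ^ 2) := by
  rw [legendreShifted_eq_laplaceSum n (outerRoot_mul_innerRoot u) (outerRoot_add_innerRoot u),
    laplaceSum_eq n (outerRoot_mul_innerRoot u), laplaceTail]

theorem norm_legendreShifted_le (n : ℕ) {u : ℂ} (h : 0 ≤ u.im) :
    ‖legendreShifted n u‖ ≤ ‖outerRoot u‖ ^ n := by
  rw [legendreShifted_eq_laplaceSum n (outerRoot_mul_innerRoot u) (outerRoot_add_innerRoot u)]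
  exact norm_laplaceSum_le n (outerRoot_mul_innerRoot u) (one_le_norm_outerRoot h)

/-- The product of Legendre polynomials whose circle average is an Apéry polynomial. -/
noncomputable def legendreProduct (r : ℝ) (n : ℕ) (φ : ℝ) : ℂ :=
  legendreShifted n (circlePoint r φ) * legendreShifted n (circlePoint r (-φ))

theorem continuous_legendreProduct (r : ℝ) (n : ℕ) : Continuous (legendreProduct r n) := by
  have : Continuous (legendreShifted n) := by unfold legendreShifted; fun_prop
  have h2 := continuous_circlePoint r
  unfold legendreProduct
  fun_prop

theorem continuousAt_innerRoot_circlePoint {r : ℝ} (hr : 0 < r) :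
    ContinuousAt (fun φ : ℝ => innerRoot (circlePoint r φ)) 0 := by
  simp only [innerRoot_eq_inv]
  exact (hasDerivAt_outerRoot_circlePoint hr (by simp; positivity)).continuousAt.inv₀
    (outerRoot_ne_zero _)

theorem norm_innerRoot_sq_lt_one {r : ℝ} (hr : 0 < r) : ‖innerRoot (circlePoint r 0) ^ 2‖ < 1 := by
  rw [innerRoot_eq_inv, norm_pow, norm_inv]
  exact pow_lt_one₀ (by positivity)
    (inv_lt_one_of_one_lt₀ (one_lt_norm_outerRoot_circlePoint_zero hr)) two_ne_zero

theorem tendsto_legendreProduct {r : ℝ} (hr : 0 < r) (t : ℝ) :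
    Tendsto (fun n : ℕ => (n : ℂ) * (outerRoot (circlePoint r 0) ^ (2 * n))⁻¹ *
      legendreProduct r n (t / √n)) atTop
      (𝓝 ((Real.pi : ℂ)⁻¹ * (1 - innerRoot (circlePoint r 0) ^ 2)⁻¹ *
        Complex.exp (-(saddleHessian (circlePoint r 0) / 2) * (t : ℂ) ^ 2))) := by
  have h1 := tendsto_outerRoot_mul_pow hr t
  have hc := continuousAt_innerRoot_circlePoint hr
  have hz1 : Tendsto (fun n : ℕ => innerRoot (circlePoint r (t / √n)) ^ 2) atTop
      (𝓝 (innerRoot (circlePoint r 0) ^ 2)) :=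
    (hc.tendsto.comp (tendsto_div_sqrt_natCast t)).pow 2
  have hz2 : Tendsto (fun n : ℕ => innerRoot (circlePoint r (-(t / √n))) ^ 2) atTop
      (𝓝 (innerRoot (circlePoint r 0) ^ 2)) := by
    refine (hc.tendsto.comp ?_).pow 2
    simpa using (tendsto_div_sqrt_natCast t).neg
  have hq := norm_innerRoot_sq_lt_one hr
  have h2 := ((tendsto_sqrt_mul_sum hz1 hq).mul (tendsto_sqrt_mul_sum hz2 hq)).mul h1
  have e : ∀ S : ℂ, ((1 / √Real.pi : ℝ) : ℂ) * S * (((1 / √Real.pi : ℝ) : ℂ) * S) =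
      (Real.pi : ℂ)⁻¹ * (S * S) := by
    intro S
    have : ((1 / √Real.pi : ℝ) : ℂ) * ((1 / √Real.pi : ℝ) : ℂ) = (Real.pi : ℂ)⁻¹ := by
      rw [← Complex.ofReal_mul, div_mul_div_comm, Real.mul_self_sqrt Real.pi_pos.le]
      simp
    linear_combination S * S * this
  rw [e, tsum_invSqrtCoeff_sq hq] at h2
  refine h2.congr fun n => ?_
  have hs : (√(n : ℝ) : ℂ) * (√(n : ℝ) : ℂ) = n := by
    rw [← Complex.ofReal_mul, Real.mul_self_sqrt n.cast_nonneg]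
    simp
  rw [legendreProduct, legendreShifted_eq_outerRoot_pow_mul, legendreShifted_eq_outerRoot_pow_mul,
    ← laplaceTail, ← laplaceTail, div_pow, mul_pow, ← pow_mul, ← hs, div_eq_mul_inv]
  ring

/-- The majorant for dominated convergence. For `|φ| < δ` each normalized Laplace sum is `O(1/√n)`,
which absorbs the factor `n`. Farther out `|w|` may reach `1` and that estimate fails; there `|P_n|
≤ |w|^n` is used and half of the Gaussian exponent absorbs `n`. -/
theorem exists_norm_legendreProduct_le {r : ℝ} (hr : 0 < r) :
    ∃ c > 0, ∃ C : ℝ, ∀ (n : ℕ) (φ : ℝ), |φ| ≤ Real.pi / 2 →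
      ‖(n : ℂ) * (outerRoot (circlePoint r 0) ^ (2 * n))⁻¹ * legendreProduct r n φ‖ ≤
        C * Real.exp (-c * (n * φ ^ 2)) := by
  obtain ⟨c, hc, hcb⟩ := exists_norm_outerRoot_mul_le hr
  obtain ⟨q, hq0, hq1⟩ := exists_between (norm_innerRoot_sq_lt_one hr)
  have hcont := ((continuousAt_innerRoot_circlePoint hr).pow 2).norm
  obtain ⟨δ, hδ, hδb⟩ := Metric.eventually_nhds_iff.1 (hcont.eventually (eventually_le_nhds hq0))
  set C₁ := ∑' j : ℕ, ((j : ℝ) + 1) * q ^ j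
  have hq : 0 ≤ q := (norm_nonneg _).trans hq0.le
  have hC₁ : 0 ≤ C₁ := tsum_nonneg fun j => by positivity
  set m₀ := ‖outerRoot (circlePoint r 0)‖ with hm₀
  have hm₀1 : 1 < m₀ := one_lt_norm_outerRoot_circlePoint_zero hr
  refine ⟨c / 2, by positivity, C₁ ^ 2 + 2 / (c * δ ^ 2), fun n φ hφ => ?_⟩
  have hφ' : |-φ| ≤ Real.pi / 2 := by rwa [abs_neg]
  have hn : (0 : ℝ) ≤ n := n.cast_nonneg
  set m := ‖outerRoot (circlePoint r φ)‖ with hm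
  set m' := ‖outerRoot (circlePoint r (-φ))‖ with hm'
  have hmm : m ^ n * m' ^ n ≤ m₀ ^ (2 * n) * Real.exp (-c * (n * φ ^ 2)) := by
    rw [← mul_pow]
    refine (pow_le_pow_left₀ (by positivity) (hcb φ hφ) n).trans_eq ?_
    rw [mul_pow, ← pow_mul, ← Real.exp_nat_mul]
    ring_nf
  have hE : Real.exp (-c * (n * φ ^ 2)) ≤ Real.exp (-(c / 2) * (n * φ ^ 2)) := by
    apply Real.exp_le_exp.2
    have : 0 ≤ c * (n * φ ^ 2) := by positivity
    linarith
  have hnorm : ‖(n : ℂ) * (outerRoot (circlePoint r 0) ^ (2 * n))⁻¹ * legendreProduct r n φ‖ =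
      (m₀ ^ (2 * n))⁻¹ * (n * ‖legendreProduct r n φ‖) := by
    rw [norm_mul, norm_mul, norm_inv, norm_pow, Complex.norm_natCast]
    ring
  have hD : 0 ≤ 2 / (c * δ ^ 2) := by positivity
  rw [hnorm, inv_mul_le_iff₀ (by positivity)]
  rcases lt_or_ge |φ| δ with hlt | hge
  · have z1 : ‖innerRoot (circlePoint r φ) ^ 2‖ ≤ q := hδb (by simpa using hlt)
    have z2 : ‖innerRoot (circlePoint r (-φ)) ^ 2‖ ≤ q := hδb (by simpa using hlt)
    have s1 : ‖(√n : ℂ) * laplaceTail n _‖ ≤ C₁ := norm_sqrt_mul_sum_le n hq1 z1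
    have s2 : ‖(√n : ℂ) * laplaceTail n _‖ ≤ C₁ := norm_sqrt_mul_sum_le n hq1 z2
    rw [norm_mul, Complex.norm_of_nonneg (Real.sqrt_nonneg _)] at s1 s2
    have hs := mul_le_mul s1 s2 (by positivity) hC₁
    calc (n : ℝ) * ‖legendreProduct r n φ‖ = (√n * ‖laplaceTail n (innerRoot (circlePoint r φ) ^ 2)‖ *
          (√n * ‖laplaceTail n (innerRoot (circlePoint r (-φ)) ^ 2)‖)) * (m ^ n * m' ^ n) := by
          rw [legendreProduct, legendreShifted_eq_outerRoot_pow_mul,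
            legendreShifted_eq_outerRoot_pow_mul, norm_mul, norm_mul, norm_mul, norm_pow, norm_pow]
          nth_rewrite 1 [← Real.mul_self_sqrt hn]
          ring
      _ ≤ (C₁ * C₁) * (m₀ ^ (2 * n) * Real.exp (-(c / 2) * (n * φ ^ 2))) := by
          exact mul_le_mul hs (hmm.trans (by gcongr)) (by positivity) (by positivity)
      _ ≤ m₀ ^ (2 * n) * ((C₁ ^ 2 + 2 / (c * δ ^ 2)) * Real.exp (-(c / 2) * (n * φ ^ 2))) := by
          have : 0 ≤ m₀ ^ (2 * n) * (2 / (c * δ ^ 2) * Real.exp (-(c / 2) * (n * φ ^ 2))) := by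
            positivity
          linarith
  · have hL : ‖legendreProduct r n φ‖ ≤ m ^ n * m' ^ n := by
      rw [legendreProduct, norm_mul]
      exact mul_le_mul (norm_legendreShifted_le n (circlePoint_im_nonneg hr.le hφ))
        (norm_legendreShifted_le n (circlePoint_im_nonneg hr.le hφ')) (norm_nonneg _) (by positivity)
    have hφδ : δ ^ 2 ≤ φ ^ 2 := by
      rw [← sq_abs φ]
      exact pow_le_pow_left₀ hδ.le hge 2
    have hexp : n * Real.exp (-(c / 2) * (n * φ ^ 2)) ≤ 2 / (c * δ ^ 2) := by
      rw [neg_mul, Real.exp_neg, ← div_eq_mul_inv, div_le_iff₀ (Real.exp_pos _)]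
      have h1 : c / 2 * (n * δ ^ 2) ≤ Real.exp (c / 2 * (n * φ ^ 2)) := by
        have := Real.add_one_le_exp (c / 2 * (n * φ ^ 2))
        have : c / 2 * (n * δ ^ 2) ≤ c / 2 * (n * φ ^ 2) := by gcongr
        linarith
      calc (n : ℝ) = 2 / (c * δ ^ 2) * (c / 2 * (n * δ ^ 2)) := by field_simp
        _ ≤ _ := by gcongr
    calc (n : ℝ) * ‖legendreProduct r n φ‖
        ≤ n * (m₀ ^ (2 * n) * Real.exp (-c * (n * φ ^ 2))) := by
          gcongr
          exact hL.trans hmm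
      _ = m₀ ^ (2 * n) * ((n * Real.exp (-(c / 2) * (n * φ ^ 2))) *
            Real.exp (-(c / 2) * (n * φ ^ 2))) := by
          rw [mul_assoc (n : ℝ) (Real.exp _), ← Real.exp_add]
          ring_nf
      _ ≤ m₀ ^ (2 * n) * ((C₁ ^ 2 + 2 / (c * δ ^ 2)) * Real.exp (-(c / 2) * (n * φ ^ 2))) := by
          gcongr
          nlinarith [sq_nonneg C₁]

/-- Here `√u` has argument `π/4`, and `√(1 + u) = p + iq` has `0 < q < p` because `1 + u` has
positive real part. Up to a positive factor the real part is `(p - q)(p² + 4pq + q²)`. -/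
theorem saddleHessian_re_pos {r : ℝ} (hr : 0 < r) : 0 < (saddleHessian (circlePoint r 0)).re := by
  set u := circlePoint r 0 with hu
  have him : u.im = r := by rw [hu, circlePoint_im]; simp
  have hre : u.re = 0 := by rw [hu, circlePoint_re]; simp
  have a1 := re_csqrt_pos (z := u) (by rwa [him])
  have a2 := im_csqrt_pos (z := u) (by rwa [him])
  have a3 := re_csqrt_sq_sub_im_csqrt_sq u
  have b1 := re_csqrt_pos (z := 1 + u) (by simpa [him] using hr)
  have b2 := im_csqrt_pos (z := 1 + u) (by simpa [him] using hr)
  have b3 := re_csqrt_sq_sub_im_csqrt_sq (1 + u)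
  rw [hre] at a3
  rw [Complex.add_re, Complex.one_re, hre] at b3
  have aeq : (csqrt u).re = (csqrt u).im := by nlinarith
  have hb0 : csqrt (1 + u) ^ 3 ≠ 0 := by
    intro h
    have := pow_eq_zero_iff (three_ne_zero) |>.1 h
    rw [this] at b1
    simp at b1
  rw [saddleHessian, Complex.div_re, ← add_div]
  refine div_pos ?_ (Complex.normSq_pos.2 hb0)
  set p := (csqrt (1 + u)).re
  set q := (csqrt (1 + u)).im
  have e1 : (csqrt (1 + u) ^ 3).re = p ^ 3 - 3 * p * q ^ 2 := by
    simp only [pow_succ, pow_zero, one_mul, Complex.mul_re, Complex.mul_im, p, q]; ring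
  have e2 : (csqrt (1 + u) ^ 3).im = 3 * p ^ 2 * q - q ^ 3 := by
    simp only [pow_succ, pow_zero, one_mul, Complex.mul_re, Complex.mul_im, p, q]; ring
  have hpq : q < p := by nlinarith
  rw [e1, e2, ← aeq, ← mul_add]
  refine mul_pos a1 ?_
  have : p ^ 3 - 3 * p * q ^ 2 + (3 * p ^ 2 * q - q ^ 3) =
      (p - q) * (p ^ 2 + 4 * p * q + q ^ 2) := by ring
  rw [this]
  exact mul_pos (sub_pos.2 hpq) (by positivity)

/-- Laplace's method for the circle average of the product of Legendre polynomials. -/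
theorem tendsto_integral_legendreProduct {r : ℝ} (hr : 0 < r) :
    Tendsto (fun n : ℕ => (n : ℂ) * (outerRoot (circlePoint r 0) ^ (2 * n))⁻¹ *
      ((√n : ℂ) * ∫ φ in -(Real.pi / 2)..(Real.pi / 2), legendreProduct r n φ)) atTop
      (𝓝 ((Real.pi : ℂ)⁻¹ * (1 - innerRoot (circlePoint r 0) ^ 2)⁻¹ *
        csqrt (Real.pi / (saddleHessian (circlePoint r 0) / 2)))) := by
  set K := saddleHessian (circlePoint r 0) with hK
  obtain ⟨c, hc, C, hb⟩ := exists_norm_legendreProduct_le hr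
  have hKre : 0 < (K / 2).re := by
    rw [Complex.div_ofNat_re]
    exact half_pos (saddleHessian_re_pos hr)
  have hgauss : ∫ t : ℝ, (Real.pi : ℂ)⁻¹ * (1 - innerRoot (circlePoint r 0) ^ 2)⁻¹ *
        Complex.exp (-(K / 2) * (t : ℂ) ^ 2) =
      (Real.pi : ℂ)⁻¹ * (1 - innerRoot (circlePoint r 0) ^ 2)⁻¹ * csqrt (Real.pi / (K / 2)) := by
    rw [MeasureTheory.integral_const_mul, integral_gaussian_complex hKre, csqrt, one_div]
  rw [← hgauss]
  -- The range of `t = φ √n`; the indicator lets all the integrals run over the whole line.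
  set s : ℕ → Set ℝ := fun n => Set.Ioc (-(Real.pi / 2) * √n) ((Real.pi / 2) * √n) with hs
  have key := MeasureTheory.tendsto_integral_of_dominated_convergence (μ := MeasureTheory.volume)
    (F := fun (n : ℕ) => (s n).indicator fun t : ℝ =>
      (n : ℂ) * (outerRoot (circlePoint r 0) ^ (2 * n))⁻¹ * legendreProduct r n (t / √n))
    (f := fun t : ℝ => (Real.pi : ℂ)⁻¹ * (1 - innerRoot (circlePoint r 0) ^ 2)⁻¹ *
        Complex.exp (-(K / 2) * (t : ℂ) ^ 2))
    (fun t => |C| * Real.exp (-c * t ^ 2)) ?_ ?_ ?_ ?_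
  · refine key.congr' ?_
    filter_upwards [eventually_ne_atTop 0] with n hn
    have hn' : 0 < √(n : ℝ) := by positivity
    rw [MeasureTheory.integral_indicator measurableSet_Ioc, MeasureTheory.integral_const_mul,
      ← intervalIntegral.integral_of_le (by
        have : 0 ≤ Real.pi / 2 * √n := by positivity
        linarith),
      intervalIntegral.integral_comp_div _ hn'.ne', mul_div_cancel_right₀ _ hn'.ne',
      mul_div_cancel_right₀ _ hn'.ne', Complex.real_smul]
  · intro n
    refine (Continuous.aestronglyMeasurable ?_).indicator measurableSet_Ioc
    have := continuous_legendreProduct r n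
    fun_prop
  · exact (integrable_exp_neg_mul_sq hc).const_mul _
  · intro n
    refine Eventually.of_forall fun t => ?_
    by_cases ht : t ∈ s n
    · rw [Set.indicator_of_mem ht]
      rcases Nat.eq_zero_or_pos n with rfl | hn
      · simp; positivity
      have hn' : 0 < √(n : ℝ) := by positivity
      have hle : |t / √n| ≤ Real.pi / 2 := by
        rw [abs_le, le_div_iff₀ hn', div_le_iff₀ hn']
        exact ⟨ht.1.le, ht.2⟩
      refine (hb n _ hle).trans ?_
      rw [div_pow, Real.sq_sqrt n.cast_nonneg, mul_div_cancel₀ _ (by positivity)]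
      gcongr
      exact le_abs_self C
    · rw [Set.indicator_of_notMem ht, norm_zero]
      positivity
  · refine Eventually.of_forall fun t => ?_
    refine (tendsto_legendreProduct hr t).congr' ?_
    have hlim := (Real.tendsto_sqrt_atTop.comp tendsto_natCast_atTop_atTop).const_mul_atTop
      (show 0 < Real.pi / 2 by positivity)
    filter_upwards [hlim.eventually_gt_atTop |t|] with n hn
    rw [Set.indicator_of_mem]
    simp only [Function.comp] at hn
    have := abs_lt.1 hn
    exact ⟨by linarith [this.1], this.2.le⟩

/-! ### Apéry polynomials as circle averages -/

theorem integral_exp_int_mul_I (m : ℤ) (a : ℝ) :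
    ∫ φ in a..(a + 2 * Real.pi), Complex.exp (m * Complex.I * (φ : ℂ)) =
      if m = 0 then (2 * Real.pi : ℂ) else 0 := by
  split_ifs with h
  · simp [h]
  · have hc : (m : ℂ) * Complex.I ≠ 0 := mul_ne_zero (by exact_mod_cast h) Complex.I_ne_zero
    rw [integral_exp_mul_complex hc]
    have : Complex.exp (m * Complex.I * ((a + 2 * Real.pi : ℝ) : ℂ)) =
        Complex.exp (m * Complex.I * (a : ℂ)) := by
      rw [Complex.exp_eq_exp_iff_exists_int]
      exact ⟨m, by push_cast; ring⟩
    rw [this, sub_self, zero_div]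

/-- Apéry polynomials are circle averages of products of Legendre polynomials. -/
theorem integral_legendreProduct_circle (r : ℝ) (n : ℕ) (a : ℝ) :
    ∫ φ in a..(a + 2 * Real.pi), legendreProduct r n φ =
      2 * Real.pi * ((aperyPolynomial n).eval (-r ^ 2) : ℝ) := by
  -- Since `u(φ)^k u(-φ)^l = (i r)^{k+l} e^{i(k-l)φ}`, only the diagonal `k = l` survives
  -- integration.
  have h1 : ∀ φ : ℝ, legendreProduct r n φ = ∑ k ∈ Finset.range (n + 1),
      ∑ l ∈ Finset.range (n + 1), legendreCoeff n k * legendreCoeff n l *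
        (r * Complex.I) ^ (k + l) * Complex.exp (((k - l : ℤ) : ℂ) * Complex.I * (φ : ℂ)) := by
    intro φ
    rw [legendreProduct, legendreShifted, legendreShifted, Finset.sum_mul_sum]
    refine Finset.sum_congr rfl fun k _ => Finset.sum_congr rfl fun l _ => ?_
    rw [circlePoint, circlePoint, mul_pow _ (Complex.exp _), mul_pow _ (Complex.exp _),
      ← Complex.exp_nat_mul, ← Complex.exp_nat_mul, pow_add]
    have : Complex.exp (((k - l : ℤ) : ℂ) * Complex.I * (φ : ℂ)) =
        Complex.exp (k * (φ * Complex.I)) * Complex.exp (l * ((-φ : ℝ) * Complex.I)) := by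
      rw [← Complex.exp_add]
      push_cast
      ring_nf
    rw [this]
    ring
  simp only [h1]
  rw [intervalIntegral.integral_finsetSum fun k _ => by
    apply Continuous.intervalIntegrable; fun_prop]
  have h2 : (((aperyPolynomial n).eval (-r ^ 2) : ℝ) : ℂ) = ∑ k ∈ Finset.range (n + 1),
      legendreCoeff n k * legendreCoeff n k * (r * Complex.I) ^ (k + k) := by
    rw [aperyPolynomial, Polynomial.eval_finsetSum]
    push_cast
    refine Finset.sum_congr rfl fun k _ => ?_
    rw [Polynomial.eval_mul, Polynomial.eval_C, Polynomial.eval_pow, Polynomial.eval_X,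
      legendreCoeff, ← two_mul k, pow_mul, mul_pow, Complex.I_sq]
    push_cast
    rw [mul_neg_one]
    ring
  rw [h2, Finset.mul_sum]
  refine Finset.sum_congr rfl fun k hk => ?_
  rw [intervalIntegral.integral_finsetSum fun k _ => by
    apply Continuous.intervalIntegrable; fun_prop]
  simp only [intervalIntegral.integral_const_mul, integral_exp_int_mul_I, sub_eq_zero,
    Nat.cast_inj]
  simp only [mul_ite, mul_zero]
  rw [Finset.sum_ite_eq, if_pos hk]
  ring

theorem legendreShifted_conj (n : ℕ) (u : ℂ) :
    legendreShifted n ((starRingEnd ℂ) u) = (starRingEnd ℂ) (legendreShifted n u) := by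
  simp [legendreShifted, legendreCoeff]

/-- The reflection exchanging the saddles `0` and `π`; it turns the left half of the circle into the
conjugate of the right half. -/
theorem legendreProduct_pi_sub (r : ℝ) (n : ℕ) (φ : ℝ) :
    legendreProduct r n (Real.pi - φ) = (starRingEnd ℂ) (legendreProduct r n φ) := by
  have h1 : circlePoint r (Real.pi - φ) = (starRingEnd ℂ) (circlePoint r φ) := by
    apply Complex.ext <;> simp [circlePoint_re, circlePoint_im]
  have h2 : circlePoint r (-(Real.pi - φ)) = (starRingEnd ℂ) (circlePoint r (-φ)) := by
    apply Complex.ext <;> simp [circlePoint_re, circlePoint_im, Real.sin_sub_pi, Real.cos_sub_pi]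
  rw [legendreProduct, legendreProduct, h1, h2, legendreShifted_conj, legendreShifted_conj, map_mul]

theorem aperyPolynomial_eval_eq_re_integral (r : ℝ) (n : ℕ) :
    (aperyPolynomial n).eval (-r ^ 2) =
      (∫ φ in -(Real.pi / 2)..(Real.pi / 2), legendreProduct r n φ).re / Real.pi := by
  have h := integral_legendreProduct_circle r n (-(Real.pi / 2))
  have hi : ∀ a b, IntervalIntegrable (legendreProduct r n) MeasureTheory.volume a b :=
    fun a b => (continuous_legendreProduct r n).intervalIntegrable a b
  rw [← intervalIntegral.integral_add_adjacent_intervals (hi _ (Real.pi / 2)) (hi _ _)] at h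
  have h2 : ∫ φ in (Real.pi / 2)..(-(Real.pi / 2) + 2 * Real.pi), legendreProduct r n φ =
      (starRingEnd ℂ) (∫ φ in -(Real.pi / 2)..(Real.pi / 2), legendreProduct r n φ) := by
    rw [← intervalIntegral.intervalIntegral_conj]
    simp only [← legendreProduct_pi_sub]
    rw [intervalIntegral.integral_comp_sub_left (fun φ => legendreProduct r n φ) Real.pi]
    congr 1 <;> ring
  rw [h2, Complex.add_conj] at h
  have h3 : 2 * (∫ φ in -(Real.pi / 2)..(Real.pi / 2), legendreProduct r n φ).re =
      2 * Real.pi * (aperyPolynomial n).eval (-r ^ 2) := by exact_mod_cast h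
  have := Real.pi_pos
  field_simp
  linarith

/-! ### Polar forms, choice of sign, and the parameter `θ` -/

theorem ofReal_add_mul_I_eq_polar {p : ℝ} (hp : 0 < p) (q : ℝ) :
    (p : ℂ) + q * Complex.I =
      (√(p ^ 2 + q ^ 2) : ℝ) * Complex.exp ((Real.arctan (q / p) : ℝ) * Complex.I) := by
  have h : √(p ^ 2 + q ^ 2) = p * √(1 + (q / p) ^ 2) := by
    rw [show p ^ 2 + q ^ 2 = p ^ 2 * (1 + (q / p) ^ 2) by field_simp, Real.sqrt_mul (by positivity),
      Real.sqrt_sq hp.le]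
  have h0 : √(1 + (q / p) ^ 2) ≠ 0 := by positivity
  apply Complex.ext
  · rw [Complex.re_ofReal_mul, Complex.exp_ofReal_mul_I_re, Real.cos_arctan, h]
    simp
    field_simp
  · rw [Complex.im_ofReal_mul, Complex.exp_ofReal_mul_I_im, Real.sin_arctan, h]
    simp
    field_simp

theorem eq_of_sq_eq_sq_of_re_pos {z w : ℂ} (h : z ^ 2 = w ^ 2) (hz : 0 ≤ z.re) (hw : 0 < w.re) :
    z = w := by
  rcases sq_eq_sq_iff_eq_or_eq_neg.1 h with h | h
  · exact h
  · rw [h, Complex.neg_re] at hz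
    linarith

/-- In terms of `c = cos(πθ/2)` the equation reads `√x = (1 - c²)/(2c)`, that is `(c + √x)² = x +
1`, whose only positive root is `√(x + 1) - √x`; it lies in `(0, 1)`. -/
theorem existsUnique_aperyParam {x : ℝ} (hx : 0 < x) :
    ∃! θ : ℝ, θ ∈ Set.Ioo (0 : ℝ) 1 ∧ x = aperyParam θ := by
  have hπ := Real.pi_pos
  have hsx : 0 < √x := Real.sqrt_pos.2 hx
  have hx2 : √x ^ 2 = x := Real.sq_sqrt hx.le
  set y := √(x + 1) with hy
  have hy2 : y ^ 2 = x + 1 := Real.sq_sqrt (by linarith)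
  have hy0 : 0 ≤ y := Real.sqrt_nonneg _
  have hxy : √x < y := Real.sqrt_lt_sqrt hx.le (by linarith)
  have hy1 : y - √x < 1 := by nlinarith
  have hroot : ∀ c : ℝ, 0 < c → c < 1 → ((1 - c ^ 2) ^ 2 / (4 * c ^ 2) = x ↔ c = y - √x) := by
    intro c hc hc1
    have h1 : 0 ≤ (1 - c ^ 2) / (2 * c) := div_nonneg (by nlinarith) (by linarith)
    have e1 : (1 - c ^ 2) ^ 2 / (4 * c ^ 2) = ((1 - c ^ 2) / (2 * c)) ^ 2 := by
      field_simp
      norm_num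
    rw [e1]
    constructor
    · intro h
      have h2 : √x = (1 - c ^ 2) / (2 * c) := by rw [← h, Real.sqrt_sq h1]
      have h3 : √x * (2 * c) = 1 - c ^ 2 := by rw [h2]; field_simp
      have h4 : (c + √x) ^ 2 = y ^ 2 := by nlinarith
      have := (sq_eq_sq₀ (by positivity) hy0).1 h4
      linarith
    · rintro rfl
      have h3 : (1 - (y - √x) ^ 2) / (2 * (y - √x)) = √x := by
        rw [div_eq_iff (by linarith)]
        nlinarith
      rw [h3, hx2]
  have hparam : ∀ θ, aperyParam θ = (1 - Real.cos (Real.pi / 2 * θ) ^ 2) ^ 2 /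
      (4 * Real.cos (Real.pi / 2 * θ) ^ 2) := by
    intro θ
    rw [aperyParam, ← Real.sin_sq]
    ring
  have hcos : ∀ θ ∈ Set.Ioo (0 : ℝ) 1, 0 < Real.cos (Real.pi / 2 * θ) ∧
      Real.cos (Real.pi / 2 * θ) < 1 := by
    intro θ hθ
    refine ⟨Real.cos_pos_of_mem_Ioo ⟨by nlinarith [hθ.1], by nlinarith [hθ.2]⟩, ?_⟩
    rw [← Real.cos_zero]
    exact Real.cos_lt_cos_of_nonneg_of_le_pi le_rfl (by nlinarith [hθ.2]) (by nlinarith [hθ.1])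
  set α := Real.arccos (y - √x) with hα
  have hα1 : Real.cos α = y - √x := Real.cos_arccos (by linarith) hy1.le
  have hα0 : 0 < α := Real.arccos_pos.2 hy1
  have hα2 : α < Real.pi / 2 := Real.arccos_lt_pi_div_two.2 (by linarith)
  have hθα : Real.pi / 2 * (2 / Real.pi * α) = α := by field_simp
  refine ⟨2 / Real.pi * α, ⟨⟨by positivity, ?_⟩, ?_⟩, ?_⟩
  · rw [div_mul_eq_mul_div, div_lt_one hπ]
    linarith
  · rw [hparam, hθα, hα1]
    exact ((hroot _ (by linarith) hy1).2 rfl).symm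
  · rintro θ ⟨hθ, hxθ⟩
    rw [hparam] at hxθ
    have h := (hroot _ (hcos θ hθ).1 (hcos θ hθ).2).1 hxθ.symm
    have : α = Real.pi / 2 * θ := by
      rw [hα, ← h, Real.arccos_cos (by nlinarith [hθ.1]) (by nlinarith [hθ.2])]
    rw [this]
    field_simp

/-! ### Closed forms at the saddle -/

section Saddle

variable {α : ℝ}

/-- With this radius `u(1 + u) = i r - r²` is the square of `(tan α / 2)(cos α + i)`. The sign is
fixed by the imaginary part, both square roots lying in the open first quadrant. -/
theorem csqrt_mul_csqrt_saddle (hs : 0 < Real.sin α) (hc : 0 < Real.cos α) :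
    csqrt (circlePoint (Real.sin α ^ 2 / (2 * Real.cos α)) 0) *
        csqrt (1 + circlePoint (Real.sin α ^ 2 / (2 * Real.cos α)) 0) =
      (Real.tan α / 2 * Real.cos α : ℝ) + (Real.tan α / 2 : ℝ) * Complex.I := by
  set r := Real.sin α ^ 2 / (2 * Real.cos α) with hr
  have hr0 : 0 < r := by positivity
  set u := circlePoint r 0 with hu
  have hur : u = r * Complex.I := circlePoint_zero r
  have him : 0 < u.im := by simpa [hur] using hr0
  have hsc := Real.sin_sq_add_cos_sq α
  have hsq : (csqrt u * csqrt (1 + u)) ^ 2 =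
      ((Real.tan α / 2 * Real.cos α : ℝ) + (Real.tan α / 2 : ℝ) * Complex.I) ^ 2 := by
    rw [mul_pow, csqrt_sq, csqrt_sq, hur]
    have e1 : -(r ^ 2) = (Real.tan α / 2 * Real.cos α) ^ 2 - (Real.tan α / 2) ^ 2 := by
      rw [hr, Real.tan_eq_sin_div_cos]
      field_simp
      linear_combination -hsc
    have e2 : r = 2 * (Real.tan α / 2 * Real.cos α) * (Real.tan α / 2) := by
      rw [hr, Real.tan_eq_sin_div_cos]
      field_simp
    have e1' := congrArg (fun y : ℝ => (y : ℂ)) e1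
    have e2' := congrArg (fun y : ℝ => (y : ℂ)) e2
    push_cast at e1' e2' ⊢
    linear_combination (r ^ 2 - (Complex.tan α / 2) ^ 2) * Complex.I_sq + e1' + Complex.I * e2'
  rcases sq_eq_sq_iff_eq_or_eq_neg.1 hsq with h | h
  · exact h
  · exfalso
    have a1 := re_csqrt_pos him
    have a2 := im_csqrt_pos him
    have b1 := re_csqrt_pos (z := 1 + u) (by simpa using him)
    have b2 := im_csqrt_pos (z := 1 + u) (by simpa using him)
    have h1 := congrArg Complex.im h
    rw [Complex.mul_im] at h1
    simp only [Complex.neg_im, Complex.add_im, Complex.ofReal_im, Complex.im_ofReal_mul,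
      Complex.I_im, zero_add, mul_one] at h1
    have : 0 < Real.tan α := by rw [Real.tan_eq_sin_div_cos]; positivity
    nlinarith [mul_pos a1 b2, mul_pos a2 b1]

/-- From `w = 1 + 2u + 2√u √(1 + u)`. The modulus gives the exponential growth of `B_n`, and the
argument `α = πθ/2` gives the oscillation `e^{iπnθ}` of `w^{2n}`. -/
theorem outerRoot_saddle (hs : 0 < Real.sin α) (hc : 0 < Real.cos α) :
    outerRoot (circlePoint (Real.sin α ^ 2 / (2 * Real.cos α)) 0) =
      ((1 + Real.sin α) / Real.cos α : ℝ) * Complex.exp (α * Complex.I) := by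
  have hab := csqrt_mul_csqrt_saddle hs hc
  set r := Real.sin α ^ 2 / (2 * Real.cos α) with hr
  set u := circlePoint r 0 with hu
  have hur : u = r * Complex.I := circlePoint_zero r
  have e0 : outerRoot u = 1 + 2 * u + 2 * (csqrt u * csqrt (1 + u)) := by
    rw [outerRoot]
    linear_combination csqrt_sq u + csqrt_sq (1 + u)
  have e1 : outerRoot u = ((1 + Real.tan α * Real.cos α : ℝ) : ℂ) +
      ((2 * r + Real.tan α : ℝ) : ℂ) * Complex.I := by
    rw [e0, hab, hur]
    push_cast
    ring
  rw [e1]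
  apply Complex.ext
  · rw [Complex.re_ofReal_mul, Complex.exp_ofReal_mul_I_re, Complex.add_re, Complex.ofReal_re,
      Complex.re_ofReal_mul, Complex.I_re, Real.tan_eq_sin_div_cos]
    field_simp
    ring
  · rw [Complex.im_ofReal_mul, Complex.exp_ofReal_mul_I_im, Complex.add_im, Complex.ofReal_im,
      Complex.im_ofReal_mul, Complex.I_im, Real.tan_eq_sin_div_cos, hr]
    field_simp
    ring

/-- The contribution of the saddle point, in polar form. -/
theorem saddle_constant (hs : 0 < Real.sin α) (hc : 0 < Real.cos α) :
    (Real.pi : ℂ)⁻¹ *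
        (1 - innerRoot (circlePoint (Real.sin α ^ 2 / (2 * Real.cos α)) 0) ^ 2)⁻¹ *
        csqrt (Real.pi / (saddleHessian (circlePoint (Real.sin α ^ 2 / (2 * Real.cos α)) 0) / 2)) =
      ((√(2 * Real.pi) / (4 * Real.pi) *
        ((1 + Real.sin α) * (1 + 1 / 2 * Real.tan α ^ 2) /
          (1 / 2 * Real.tan α * √(1 + Real.cos α ^ 2)) ^ (3 / 2 : ℝ)) : ℝ) : ℂ) *
        Complex.exp ((2 * Real.arctan (Real.tan α * (1 + Real.sin α) / (2 + Real.sin α))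
          - 3 / 2 * Real.arctan (1 / Real.cos α) : ℝ) * Complex.I) := by
  have hab := csqrt_mul_csqrt_saddle hs hc
  set r := Real.sin α ^ 2 / (2 * Real.cos α) with hr
  have hr0 : 0 < r := by positivity
  set u := circlePoint r 0 with hu
  have hur : u = r * Complex.I := circlePoint_zero r
  have him : 0 < u.im := by simpa [hur] using hr0
  have hsc := Real.sin_sq_add_cos_sq α
  have hπ := Real.pi_pos
  have ht : 0 < Real.tan α := by rw [Real.tan_eq_sin_div_cos]; positivity
  set a := csqrt u with ha
  set b := csqrt (1 + u) with hb
  have hb2 : b ^ 2 = 1 + u := csqrt_sq (1 + u)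
  have a0 : a ≠ 0 := csqrt_ne_zero (Complex.slitPlane_ne_zero (Or.inr him.ne'))
  have b0 : b ≠ 0 := csqrt_ne_zero (Complex.slitPlane_ne_zero (one_add_mem_slitPlane him))
  set β := Real.arctan (1 / Real.cos α) with hβ
  set γ := Real.arctan (Real.tan α * (1 + Real.sin α) / (2 + Real.sin α)) with hγ
  set M := 1 / 2 * Real.tan α * √(1 + Real.cos α ^ 2) with hM
  have hM0 : 0 < M := by positivity
  have hβ0 : 0 < β := Real.arctan_pos.2 (by positivity)
  have hβ1 : β < Real.pi / 2 := Real.arctan_lt_pi_div_two _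
  -- polar form of `a b`
  have hpolar : a * b = M * Complex.exp (β * Complex.I) := by
    rw [hab, ofReal_add_mul_I_eq_polar (by positivity)]
    have e1 : Real.tan α / 2 / (Real.tan α / 2 * Real.cos α) = 1 / Real.cos α := by field_simp
    have e2 : √((Real.tan α / 2 * Real.cos α) ^ 2 + (Real.tan α / 2) ^ 2) = M := by
      rw [show (Real.tan α / 2 * Real.cos α) ^ 2 + (Real.tan α / 2) ^ 2 =
        (1 / 2 * Real.tan α) ^ 2 * (1 + Real.cos α ^ 2) by ring, Real.sqrt_mul (by positivity),
        Real.sqrt_sq (by positivity)]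
    rw [e1, e2]
  -- A square root of `a b`, so that `η³` serves as `(a b)^{3/2}`; its argument `β/2` lies in `(0,
  -- π/4)`.
  set η : ℂ := √M * Complex.exp ((β / 2 : ℝ) * Complex.I) with hη
  have hη2 : η ^ 2 = a * b := by
    rw [hpolar, hη, mul_pow, ← Complex.ofReal_pow, Real.sq_sqrt hM0.le, ← Complex.exp_nat_mul]
    push_cast
    ring_nf
  have hη0 : η ≠ 0 := by
    intro h
    rw [h] at hη2
    exact mul_ne_zero a0 b0 (by rw [← hη2]; norm_num)
  have hη3 : η ^ 3 = ((M ^ (3 / 2 : ℝ) : ℝ) : ℂ) * Complex.exp ((3 / 2 * β : ℝ) * Complex.I) := by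
    have : √M ^ 3 = M ^ (3 / 2 : ℝ) := by
      rw [Real.sqrt_eq_rpow, ← Real.rpow_natCast, ← Real.rpow_mul hM0.le]
      norm_num
    rw [hη, mul_pow, ← Complex.ofReal_pow, this, ← Complex.exp_nat_mul]
    push_cast
    ring_nf
  -- polar form of `(b (a + b))²`
  have hN : (b * (a + b)) ^ 2 = (((1 + Real.sin α) * (1 + 1 / 2 * Real.tan α ^ 2) : ℝ) : ℂ) *
      Complex.exp ((2 * γ : ℝ) * Complex.I) := by
    set p := (2 + Real.sin α) / 2 with hp
    set q := Real.tan α * (1 + Real.sin α) / 2 with hq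
    have e0 : b * (a + b) = (p : ℂ) + q * Complex.I := by
      have : b * (a + b) = 1 + u + a * b := by linear_combination hb2
      have hp' : p = 1 + Real.tan α / 2 * Real.cos α := by
        rw [hp, Real.tan_eq_sin_div_cos]
        field_simp
      have hq' : q = r + Real.tan α / 2 := by
        rw [hq, hr, Real.tan_eq_sin_div_cos]
        field_simp
        ring
      rw [this, hab, hur, hp', hq', Complex.ofReal_add, Complex.ofReal_add, Complex.ofReal_one]
      ring
    have e1 : q / p = Real.tan α * (1 + Real.sin α) / (2 + Real.sin α) := by
      rw [hp, hq]
      field_simp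
    have e2 : p ^ 2 + q ^ 2 = (1 + Real.sin α) * (1 + 1 / 2 * Real.tan α ^ 2) := by
      have hc2 : Real.cos α ^ 2 = 1 - Real.sin α ^ 2 := by linarith
      have hc2' : 1 - Real.sin α ^ 2 ≠ 0 := by rw [← hc2]; positivity
      rw [hp, hq, Real.tan_eq_sin_div_cos]
      field_simp
      rw [hc2]
      ring
    rw [e0, ofReal_add_mul_I_eq_polar (by positivity), mul_pow, ← Complex.ofReal_pow,
      Real.sq_sqrt (by positivity), e1, e2, ← hγ, ← Complex.exp_nat_mul]
    push_cast
    ring_nf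
  -- As `2π/K = 2π b³/a = 2π b⁴/(a b)`, the two sides agree up to sign, and positivity of the real
  -- part of `b²/η` decides it.
  have hG : csqrt (Real.pi / (saddleHessian u / 2)) = √(2 * Real.pi) * (b ^ 2 / η) := by
    refine eq_of_sq_eq_sq_of_re_pos ?_ (re_csqrt_nonneg _) ?_
    · rw [csqrt_sq, saddleHessian, ← ha, ← hb, mul_pow, div_pow, hη2, ← Complex.ofReal_pow,
        Real.sq_sqrt (by positivity)]
      push_cast
      field_simp
    · rw [Complex.re_ofReal_mul, Complex.div_re, ← add_div]
      refine mul_pos (by positivity) (div_pos ?_ (Complex.normSq_pos.2 hη0))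
      have hre : η.re = √M * Real.cos (β / 2) := by
        rw [hη, Complex.re_ofReal_mul, Complex.exp_ofReal_mul_I_re]
      have him' : η.im = √M * Real.sin (β / 2) := by
        rw [hη, Complex.im_ofReal_mul, Complex.exp_ofReal_mul_I_im]
      have c1 : 0 < Real.cos (β / 2) := Real.cos_pos_of_mem_Ioo ⟨by linarith, by linarith⟩
      have c2 : 0 < Real.sin (β / 2) := Real.sin_pos_of_pos_of_lt_pi (by linarith) (by linarith)
      rw [hb2, hur, hre, him']
      simp
      positivity
  -- From `w = (a + b)²`, `w - w⁻¹ = 4ab` and `1 - w⁻² = w⁻¹(w - w⁻¹)`.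
  have hw : (1 - innerRoot u ^ 2)⁻¹ = (a + b) ^ 2 / (4 * (a * b)) := by
    have h1 := outerRoot_mul_innerRoot u
    have h2 : (a + b) ^ 2 = outerRoot u := rfl
    have h3 : 4 * (a * b) = outerRoot u - innerRoot u := by
      rw [outerRoot, innerRoot, ← ha, ← hb]
      ring
    have h4 : 1 - innerRoot u ^ 2 = innerRoot u * (outerRoot u - innerRoot u) := by
      linear_combination -h1
    rw [h4, ← h3, h2, mul_inv, innerRoot_eq_inv, inv_inv, div_eq_mul_inv]
  have hE : Complex.exp ((2 * γ - 3 / 2 * β : ℝ) * Complex.I) =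
      Complex.exp ((2 * γ : ℝ) * Complex.I) / Complex.exp ((3 / 2 * β : ℝ) * Complex.I) := by
    rw [← Complex.exp_sub]
    push_cast
    ring_nf
  have hMr : ((M ^ (3 / 2 : ℝ) : ℝ) : ℂ) ≠ 0 := by
    exact_mod_cast (Real.rpow_pos_of_pos hM0 _).ne'
  have hexp := Complex.exp_ne_zero ((3 / 2 * β : ℝ) * Complex.I)
  have hπ' : (Real.pi : ℂ) ≠ 0 := by exact_mod_cast hπ.ne'
  calc (Real.pi : ℂ)⁻¹ * (1 - innerRoot u ^ 2)⁻¹ * csqrt (Real.pi / (saddleHessian u / 2))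
      = (√(2 * Real.pi) : ℂ) / (4 * Real.pi) * ((b * (a + b)) ^ 2 / η ^ 3) := by
        rw [hw, hG, ← hη2]
        field_simp
    _ = _ := by
        rw [hN, hη3, hE]
        push_cast
        field_simp

end Saddle

/-! ### Assembly of the asymptotic formula -/

theorem theorem4p2 (x : ℝ) (hx : 0 < x) :
    (∃! θ : ℝ, θ ∈ Set.Ioo (0 : ℝ) 1 ∧ x = aperyParam θ) ∧
    ∀ θ ∈ Set.Ioo (0 : ℝ) 1, x = aperyParam θ →
      ∃ ε : ℕ → ℝ, Tendsto ε atTop (𝓝 0) ∧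
        ∀ n : ℕ, 1 ≤ n →
          (aperyPolynomial n).eval (-x) =
            1 / (2 * Real.pi * (n : ℝ)) ^ (3 / 2 : ℝ) * aperyAmplitude θ *
              ((1 + Real.sin (Real.pi / 2 * θ)) / Real.cos (Real.pi / 2 * θ)) ^ (2 * n) *
              (Real.cos (aperyPhase θ + (n : ℝ) * Real.pi * θ) + ε n) := by
  refine ⟨existsUnique_aperyParam hx, fun θ hθ hxθ => ?_⟩
  have hπ := Real.pi_pos
  set α := Real.pi / 2 * θ with hα
  have hα0 : 0 < α := mul_pos (by positivity) hθ.1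
  have hα1 : α < Real.pi / 2 := mul_lt_of_lt_one_right (by positivity) hθ.2
  have hs : 0 < Real.sin α := Real.sin_pos_of_pos_of_lt_pi hα0 (by linarith)
  have hc : 0 < Real.cos α := Real.cos_pos_of_mem_Ioo ⟨by linarith, hα1⟩
  have ht : 0 < Real.tan α := by rw [Real.tan_eq_sin_div_cos]; positivity
  set r := Real.sin α ^ 2 / (2 * Real.cos α) with hr
  have hr0 : 0 < r := by positivity
  have hxr : x = r ^ 2 := by
    rw [hxθ, aperyParam, ← hα, hr]
    ring
  have hlim := tendsto_integral_legendreProduct hr0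
  rw [saddle_constant hs hc] at hlim
  have hamp : 0 < aperyAmplitude θ := by
    rw [aperyAmplitude, ← hα]
    positivity
  -- Divided by the `π` of the half-circle formula, `κ` becomes `(2π)^{-3/2}`.
  set κ := √(2 * Real.pi) / (4 * Real.pi) with hκ
  have hκ0 : 0 < κ := by positivity
  set J : ℕ → ℂ := fun n => ∫ φ in -(Real.pi / 2)..(Real.pi / 2), legendreProduct r n φ with hJ
  set Z : ℕ → ℂ := fun n => (n : ℂ) * (outerRoot (circlePoint r 0) ^ (2 * n))⁻¹ *
      ((√n : ℂ) * J n) with hZ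
  set C : ℂ := ((κ * aperyAmplitude θ : ℝ) : ℂ) * Complex.exp (aperyPhase θ * Complex.I) with hC
  have hlim' : Tendsto Z atTop (𝓝 C) := hlim
  set Λ := (1 + Real.sin α) / Real.cos α with hΛ
  have hΛ0 : 0 < Λ := by positivity
  have hw : ∀ n : ℕ, outerRoot (circlePoint r 0) ^ (2 * n) =
      ((Λ ^ (2 * n) : ℝ) : ℂ) * Complex.exp ((n * Real.pi * θ : ℝ) * Complex.I) := by
    intro n
    rw [outerRoot_saddle hs hc, ← hΛ, mul_pow, ← Complex.exp_nat_mul, ← Complex.ofReal_pow]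
    congr 2
    rw [hα]
    push_cast
    ring
  -- The normalized error of the integral, rotated by the phase of `w^{2n}`. The rotation is
  -- unimodular, so `|Z n - C|` controls it.
  refine ⟨fun n => ((Z n - C) * Complex.exp ((n * Real.pi * θ : ℝ) * Complex.I)).re /
    (κ * aperyAmplitude θ), ?_, fun n hn => ?_⟩
  · have h0 : Tendsto (fun n => ‖Z n - C‖ / (κ * aperyAmplitude θ)) atTop (𝓝 0) := by
      have := (tendsto_iff_norm_sub_tendsto_zero.1 hlim').div_const (κ * aperyAmplitude θ)
      rwa [zero_div] at this
    refine squeeze_zero_norm (fun n => ?_) h0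
    rw [Real.norm_eq_abs, abs_div, abs_of_pos (mul_pos hκ0 hamp)]
    gcongr
    refine (Complex.abs_re_le_norm _).trans_eq ?_
    rw [norm_mul, Complex.norm_exp_ofReal_mul_I, mul_one]
  · have hn' : (0 : ℝ) < n := by exact_mod_cast hn
    have hnC : (n : ℂ) ≠ 0 := by exact_mod_cast hn'.ne'
    have hsn : (√(n : ℝ) : ℂ) ≠ 0 := by exact_mod_cast (Real.sqrt_pos.2 hn').ne'
    have hCre : (C * Complex.exp ((n * Real.pi * θ : ℝ) * Complex.I)).re =
        κ * aperyAmplitude θ * Real.cos (aperyPhase θ + n * Real.pi * θ) := by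
      rw [hC, mul_assoc, ← Complex.exp_add, Complex.re_ofReal_mul, ← add_mul,
        ← Complex.ofReal_add, Complex.exp_ofReal_mul_I_re]
    have hJn : J n = ((Λ ^ (2 * n) / (n * √n) : ℝ) : ℂ) *
        (Z n * Complex.exp ((n * Real.pi * θ : ℝ) * Complex.I)) := by
      have hΛC : (Λ : ℂ) ≠ 0 := by exact_mod_cast hΛ0.ne'
      have := Complex.exp_ne_zero ((n * Real.pi * θ : ℝ) * Complex.I)
      simp only [hZ]
      rw [hw n]
      push_cast at this ⊢
      field_simp
    have hB : (aperyPolynomial n).eval (-x) = (J n).re / Real.pi := by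
      rw [hxr]
      exact aperyPolynomial_eval_eq_re_integral r n
    have hpow : (2 * Real.pi * (n : ℝ)) ^ (3 / 2 : ℝ) =
        2 * Real.pi * √(2 * Real.pi) * (n * √n) := by
      rw [show (3 / 2 : ℝ) = 1 + 1 / 2 by norm_num, Real.rpow_add (by positivity), Real.rpow_one,
        ← Real.sqrt_eq_rpow, Real.sqrt_mul (by positivity)]
      ring
    beta_reduce
    rw [hB, hJn, Complex.re_ofReal_mul, hpow, sub_mul, Complex.sub_re, hCre, hκ]
    have hsn' : 0 < √(n : ℝ) := Real.sqrt_pos.2 hn'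
    field_simp
    rw [Real.sq_sqrt (by positivity)]
    ring
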